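/- Let $H$ be a separable complex Hilbert space, let $(T_l)_{l\in\mathbb Z}$ be operators in $\mathcal B(H)$ and let $\mathbf A=(T_{j-k})_{k,j\in\mathbb N}$ be the associated Toeplitz matrix. Let $\mathcal B(\ell^2(H))_{\mathcal T}$ denote the set of Toeplitz matrices $\mathbf B=(S_{j-k})_{k,j}$ with entries in $\mathcal B(H)$ that define bounded operators on $\ell^2(H)$, and for such matrices let $\mathbf B*\mathbf A=(S_{j-k}T_{j-k})_{k,j}$ be the Schur product (entrywise composition). Write $\mathbf A\in(\mathcal B(\ell^2(H))_{\mathcal T},\mathcal B(\ell^2(H))_{\mathcal T})_r$ if $\mathbf B*\mathbf A\in\mathcal B(\ell^2(H))_{\mathcal T}$ for every $\mathbf B\in\mathcal B(\ell^2(H))_{\mathcal T}$, and let $$\|\mathbf A\|_{r,\mathcal T}=\inf\{C\ge 0:\ \|\mathbf B*\mathbf A\|_{\mathcal B(\ell^2(H))}\le C\|\mathbf B\|_{\mathcal B(\ell^2(H))}\ \text{ for all } \mathbf B\in\mathcal B(\ell^2(H))_{\mathcal T}\}$$ be the corresponding multiplier norm. Let $M_{SOT}(\mathbb T,\mathcal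 B(H))$ be the space of regular (countably additive) Borel vector measures $\mu$ on $\mathbb T=\mathbb R/2\pi\mathbb Z$ with values in $\mathcal B(H)$ such that, for every $x\in H$, the $H$-valued measure $\mu_x(E)=\mu(E)x$ has bounded variation $|\mu_x|$, with norm $\|\mu\|_{M_{SOT}}=\sup_{\|x\|=1}|\mu_x|(\mathbb T)$, and let $\widehat\mu(l)=\int_{\mathbb T}e^{-ilt}\,d\mu(t)$. Then $\mathbf A\in(\mathcal B(\ell^2(H))_{\mathcal T},\mathcal B(\ell^2(H))_{\mathcal T})_r$ if and only if there exists $\mu\in M_{SOT}(\mathbb T,\mathcal B(H))$ such that $\widehat\mu(l)=T_{-l}$ for all $l\in\mathbb Z$. Furthermore, every such $\mu$ satisfies $\|\mu\|_{M_{SOT}}=\|\mathbf A\|_{r,\mathcal T}<\infty$. -/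

import Mathlib

open MeasureTheory
open scoped ENNReal NNReal Matrix

namespace OperatorMatrix

variable {H : Type*} [NormedAddCommGroup H] [InnerProductSpace ℂ H]

/-! ### Matrices with operator entries -/

/-- The `k`-th coordinate of `𝐀 𝐱`, that is `∑ⱼ T_{kj} xⱼ`, for a matrix `𝐀 = (T_{kj})` and
a finitely supported sequence `𝐱` of vectors of `H`. -/
noncomputable def mulVecCoord (A : Matrix ℕ ℕ (H →L[ℂ] H)) (x : ℕ →₀ H) (k : ℕ) : H :=
  x.sum fun j v => A k j v

/-- The inequality `‖𝐀 𝐱‖ ≤ C ‖𝐱‖` in `ℓ²(H)` for all finitely supported `𝐱`; both squared norms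
are sums in `[0, ∞]`, so that it includes the claim that `𝐀 𝐱` lies in `ℓ²(H)`. -/
def BoundedBy (A : Matrix ℕ ℕ (H →L[ℂ] H)) (C : ℝ≥0) : Prop :=
  ∀ x : ℕ →₀ H, ∑' k, ‖mulVecCoord A x k‖ₑ ^ 2 ≤ (C : ℝ≥0∞) ^ 2 * ∑' j, ‖x j‖ₑ ^ 2

/-- The matrix defines a bounded operator on `ℓ²(H)`. -/
def IsBoundedOp (A : Matrix ℕ ℕ (H →L[ℂ] H)) : Prop :=
  ∃ C : ℝ≥0, BoundedBy A C

/-- The operator norm on `ℓ²(H)` (the value is `∞` if the matrix is not bounded). -/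
noncomputable def opNorm (A : Matrix ℕ ℕ (H →L[ℂ] H)) : ℝ≥0∞ :=
  ⨅ (C : ℝ≥0) (_ : BoundedBy A C), (C : ℝ≥0∞)

/-- The Toeplitz matrix `(T_{j-k})_{k,j}`. -/
def toeplitz (T : ℤ → H →L[ℂ] H) : Matrix ℕ ℕ (H →L[ℂ] H) :=
  fun k j => T ((j : ℤ) - (k : ℤ))

/-- The Toeplitz matrices that define bounded operators on `ℓ²(H)`. -/
def boundedToeplitz (H : Type*) [NormedAddCommGroup H] [InnerProductSpace ℂ H] :
    Set (Matrix ℕ ℕ (H →L[ℂ] H)) :=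
  {B | IsBoundedOp B ∧ ∃ S : ℤ → H →L[ℂ] H, B = toeplitz S}

/-- `𝐀` is a right Schur multiplier from the bounded Toeplitz matrices to themselves. The Schur
product `𝐁 ⊙ 𝐀` is entrywise, with entries `S_{kj} ∘ T_{kj}`. -/
def IsRightToeplitzMultiplier (A : Matrix ℕ ℕ (H →L[ℂ] H)) : Prop :=
  ∀ B ∈ boundedToeplitz H, B ⊙ A ∈ boundedToeplitz H

/-- The norm of `𝐀` as a right Schur multiplier on bounded Toeplitz matrices: the infimum of the
`C ≥ 0` such that `‖𝐁 ⊙ 𝐀‖ ≤ C ‖𝐁‖` for all `𝐁` (the value is `∞` if there is no such `C`). -/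
noncomputable def rightToeplitzMultiplierNorm (A : Matrix ℕ ℕ (H →L[ℂ] H)) : ℝ≥0∞ :=
  ⨅ (C : ℝ≥0) (_ : ∀ B ∈ boundedToeplitz H, opNorm (B ⊙ A) ≤ C * opNorm B), (C : ℝ≥0∞)

/-! ### Operator-valued measures on the circle -/

/-- The circle, as `ℝ / 2πℤ`. -/
abbrev Torus : Type := AddCircle (2 * Real.pi)

/-- A vector measure is regular if every Borel set can be approximated from inside by compact sets
and from outside by open sets, in semivariation. -/
def IsRegular {E : Type*} [NormedAddCommGroup E] [NormedSpace ℝ E] (μ : VectorMeasure Torus E) :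
    Prop :=
  ∀ s : Set Torus, MeasurableSet s → ∀ ε : ℝ≥0∞, 0 < ε →
    ∃ K U : Set Torus, IsCompact K ∧ IsOpen U ∧ K ⊆ s ∧ s ⊆ U ∧ μ.semivariation (U \ K) < ε

/-- The `H`-valued measure `μ_x(E) = μ(E) x`. -/
noncomputable def applyMeasure (μ : VectorMeasure Torus (H →L[ℂ] H)) (x : H) :
    VectorMeasure Torus H :=
  μ.mapRange (ContinuousLinearMap.apply ℂ H x : (H →L[ℂ] H) →+ H)
    (ContinuousLinearMap.apply ℂ H x).continuous

/-- Membership in `M_SOT(𝕋, B(H))`: regular measures such that every `μ_x` has bounded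
variation. -/
def IsSOTMeasure (μ : VectorMeasure Torus (H →L[ℂ] H)) : Prop :=
  IsRegular μ ∧ ∀ x : H, (applyMeasure μ x).variation Set.univ < ∞

/-- The norm of `M_SOT(𝕋, B(H))`: the supremum over unit vectors `x` of the total variation
of `μ_x`. -/
noncomputable def sotNorm (μ : VectorMeasure Torus (H →L[ℂ] H)) : ℝ≥0∞ :=
  ⨆ (x : H) (_ : ‖x‖ = 1), (applyMeasure μ x).variation Set.univ

/-- The integral of a simple function against a vector measure. -/
noncomputable def simpleIntegral (μ : VectorMeasure Torus (H →L[ℂ] H))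
    (s : SimpleFunc Torus ℂ) : H →L[ℂ] H :=
  ∑ c ∈ s.range, c • μ (s ⁻¹' {c})

/-- `∫ f dμ = I`, for a function `f` that is a uniform limit of simple functions (for instance a
continuous one): the integrals of simple functions tend to `I` as these tend uniformly to `f`. -/
def HasIntegral (μ : VectorMeasure Torus (H →L[ℂ] H)) (f : Torus → ℂ) (I : H →L[ℂ] H) : Prop :=
  ∀ ε : ℝ, 0 < ε → ∃ δ : ℝ, 0 < δ ∧ ∀ s : SimpleFunc Torus ℂ,
    (∀ t, ‖s t - f t‖ ≤ δ) → ‖simpleIntegral μ s - I‖ ≤ ε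

/-- `μ̂(l) = I`, where `μ̂(l) = ∫ e^{-ilt} dμ(t)`; on `ℝ / 2πℤ`, Mathlib's `fourier n` is
the function `t ↦ e^{int}`. -/
def HasFourierCoeff (μ : VectorMeasure Torus (H →L[ℂ] H)) (l : ℤ) (I : H →L[ℂ] H) : Prop :=
  HasIntegral μ (fun t => fourier (-l) t) I

end OperatorMatrix

/-! # Schur multipliers on Toeplitz matrices and operator-valued measures -/

open Filter Topology

namespace OperatorMatrix

variable {H : Type*} [NormedAddCommGroup H] [InnerProductSpace ℂ H]

/-! ### Discrete Fourier analysis on the circle -/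

/-! A bounded Toeplitz matrix acts as multiplication by its symbol `∑ Sₗ e^{ilt}`, compressed to a
half-line, and its norm is the supremum of the norms of the Fejér means of that symbol
(`norm_fejer_le_of_boundedBy`, `boundedBy_of_norm_fejer_le`). The theorem thus concerns coefficient
multipliers `Sₗ ↦ Sₗ Tₗ` on series with bounded Fejér means, and uniform boundedness supplies a
constant `C` (`exists_isFejerMultiplier`).

If `μ` represents `T`, that is `∫ e^{ils} dμ(s) = Tₗ`, then the Fejér mean of `(Sₗ Tₗ)` at `t`,
applied to `x`, is the integral of the translated Fejér mean of `S` against `μ_x`. Hence `‖μ‖_SOT`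
is a multiplier constant; it is finite by uniform boundedness again (`sotNorm_lt_top`).

Conversely, fix `x` and let `Ψ_x` send `∑ pₗ e^{ilt}` to `∑ pₗ Tₗ x`. Testing the multiplier on
symbols made of rank-one operators gives `∑ᵢ ‖Ψ_x pᵢ‖ ≤ C ‖x‖ sup ∑ᵢ |pᵢ|`
(`IsFejerMultiplier.isSumming`). A weak limit of discrete measures then yields a positive measure
`ν_x` of mass at most `C ‖x‖` with `‖Ψ_x p‖ ≤ ∫ |p| dν_x` (`IsSumming.exists_dominating_measure`).
So `Ψ_x` extends to `L¹(ν_x)`, and its values at indicators define `μ(E) x`. The same domination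
bounds `|μ_x|` for every representing measure, which gives the equality of norms.

Domination holds only vector by vector, whereas countable additivity and regularity are required in
operator norm. Here the geometry of Hilbert space enters: at most `C² / ε²` disjoint sets can
satisfy `‖μ(E)‖ > ε` (`card_mul_sq_le`), so a sliding hump makes strong smallness along decreasing
sets uniform (`exists_norm_le`). For regularity, separability provides one such sequence of sets
that serves all vectors. -/

/-- The `m`-th of the `M` equidistributed points on the circle. -/
noncomputable def node (M m : ℕ) : Torus := ((2 * Real.pi * m / M : ℝ) : Torus)

lemma norm_fourier_apply (n : ℤ) (t : Torus) : ‖fourier n t‖ = 1 := by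
  rw [fourier_apply]; exact Circle.norm_coe _

lemma fourier_node (M m : ℕ) (hM : M ≠ 0) (l : ℤ) :
    fourier l (node M m) = (Complex.exp (2 * Real.pi * Complex.I / M) ^ l) ^ m := by
  have hM' : (M : ℂ) ≠ 0 := by exact_mod_cast hM
  have hpi : (Real.pi : ℂ) ≠ 0 := by exact_mod_cast Real.pi_ne_zero
  rw [node, fourier_coe_apply, ← Complex.exp_int_mul, ← Complex.exp_nat_mul]
  congr 1
  push_cast
  field_simp

lemma sum_fourier_node {M : ℕ} {l : ℤ} (hl : |l| < M) :
    ∑ m ∈ Finset.range M, fourier l (node M m) = if l = 0 then (M : ℂ) else 0 := by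
  have hM : M ≠ 0 := by rintro rfl; have := abs_nonneg l; simp at hl; omega
  simp only [fourier_node _ _ hM]
  split_ifs with h
  · simp [h]
  · have hp := Complex.isPrimitiveRoot_exp M hM
    have hne : Complex.exp (2 * Real.pi * Complex.I / M) ^ l ≠ 1 := by
      rw [Ne, hp.zpow_eq_one_iff_dvd]
      exact fun hd => h (Int.eq_zero_of_abs_lt_dvd hd hl)
    have h1 := geom_sum_mul (Complex.exp (2 * Real.pi * Complex.I / M) ^ l) M
    rw [← zpow_natCast, ← zpow_mul, mul_comm l, zpow_mul, zpow_natCast, hp.pow_eq_one, one_zpow,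
      sub_self] at h1
    exact (mul_eq_zero.1 h1).resolve_right (sub_ne_zero.2 hne)

/-- The trigonometric polynomial `∑ₙ yₙ e^{int}` with vector coefficients. -/
noncomputable def vtrig {E : Type*} [NormedAddCommGroup E] [NormedSpace ℂ E] (y : ℤ →₀ E)
    (t : Torus) : E :=
  y.sum fun n v => fourier n t • v

section vtrig
variable {E : Type*} [NormedAddCommGroup E] [NormedSpace ℂ E]

lemma vtrig_single (n : ℤ) (v : E) (t : Torus) :
    vtrig (Finsupp.single n v) t = fourier n t • v := by
  simp [vtrig]

lemma vtrig_add (y z : ℤ →₀ E) (t : Torus) : vtrig (y + z) t = vtrig y t + vtrig z t := by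
  rw [vtrig, Finsupp.sum_add_index'] <;> simp [vtrig, smul_add]

lemma vtrig_zero (t : Torus) : vtrig (0 : ℤ →₀ E) t = 0 := by simp [vtrig]

lemma vtrig_sum {ι : Type*} (s : Finset ι) (y : ι → ℤ →₀ E) (t : Torus) :
    vtrig (∑ i ∈ s, y i) t = ∑ i ∈ s, vtrig (y i) t := by
  classical
  induction s using Finset.induction_on with
  | empty => simp [vtrig_zero]
  | insert a s ha ih => rw [Finset.sum_insert ha, Finset.sum_insert ha, vtrig_add, ih]

end vtrig

/-- Parseval without integrals: once `M` exceeds all differences of frequencies, averaging over the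
nodes kills every cross term exactly. -/
lemma sum_norm_sq_vtrig_node (y : ℤ →₀ H) :
    ∀ᶠ M : ℕ in atTop, ∑ m ∈ Finset.range M, ‖vtrig y (node M m)‖ ^ 2
      = M * y.sum fun _ v => ‖v‖ ^ 2 := by
  obtain ⟨R, hR⟩ : ∃ R : ℕ, ∀ a ∈ y.support, ∀ b ∈ y.support, |a - b| < R := by
    refine ⟨(∑ a ∈ y.support, ∑ b ∈ y.support, |a - b|).toNat + 1, fun a ha b hb => ?_⟩
    have h1 : |a - b| ≤ ∑ b ∈ y.support, |a - b| :=
      Finset.single_le_sum (f := fun b => |a - b|) (fun _ _ => abs_nonneg _) hb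
    have h2 : ∑ b ∈ y.support, |a - b| ≤ ∑ a ∈ y.support, ∑ b ∈ y.support, |a - b| :=
      Finset.single_le_sum (f := fun a => ∑ b ∈ y.support, |a - b|)
        (fun _ _ => Finset.sum_nonneg fun _ _ => abs_nonneg _) ha
    omega
  filter_upwards [eventually_ge_atTop R] with M hM
  have key : ∀ t : Torus, ((‖vtrig y t‖ ^ 2 : ℝ) : ℂ)
      = ∑ a ∈ y.support, ∑ b ∈ y.support, fourier (b - a) t * inner ℂ (y a) (y b) := by
    intro t
    have : ((‖vtrig y t‖ ^ 2 : ℝ) : ℂ) = inner ℂ (vtrig y t) (vtrig y t) := by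
      rw [inner_self_eq_norm_sq_to_K]; simp
    rw [this, vtrig, Finsupp.sum, sum_inner]
    refine Finset.sum_congr rfl fun a _ => ?_
    rw [inner_sum]
    refine Finset.sum_congr rfl fun b _ => ?_
    rw [inner_smul_left, inner_smul_right, ← fourier_neg, sub_eq_add_neg, fourier_add]
    ring
  have : ((∑ m ∈ Finset.range M, ‖vtrig y (node M m)‖ ^ 2 : ℝ) : ℂ)
      = ((M * y.sum fun _ v => ‖v‖ ^ 2 : ℝ) : ℂ) := by
    rw [Complex.ofReal_sum, Finset.sum_congr rfl fun m _ => key _, Finset.sum_comm]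
    rw [Complex.ofReal_mul, Finsupp.sum, Complex.ofReal_sum, Finset.mul_sum]
    refine Finset.sum_congr rfl fun a ha => ?_
    rw [Finset.sum_comm, Finset.sum_eq_single a]
    · rw [← Finset.sum_mul, sum_fourier_node ((hR a ha a ha).trans_le (Nat.cast_le.2 hM))]
      rw [inner_self_eq_norm_sq_to_K]; simp
    · intro b hb hba
      rw [← Finset.sum_mul, sum_fourier_node ((hR b hb a ha).trans_le (by exact_mod_cast hM)),
        if_neg (sub_ne_zero.2 hba), zero_mul]
    · exact fun h => (h ha).elim
  exact_mod_cast this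

/-! ### Fejér means -/

/-- The Fejér weight `(1 - |l| / N)⁺`, written as a normalised count of pairs. -/
noncomputable def fejerWeight (N : ℕ) (l : ℤ) : ℝ :=
  (((Finset.range N ×ˢ Finset.range N).filter fun q => (q.1 : ℤ) - q.2 = l).card : ℝ) / N

lemma fejerWeight_le_one (N : ℕ) (l : ℤ) : fejerWeight N l ≤ 1 := by
  refine div_le_one_of_le₀ ?_ (Nat.cast_nonneg _)
  have : ((Finset.range N ×ˢ Finset.range N).filter fun q => (q.1 : ℤ) - q.2 = l).card
      ≤ (Finset.range N).card := by
    refine Finset.card_le_card_of_injOn Prod.fst (fun q hq => ?_) (fun q hq r hr h => ?_)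
    · simp at hq ⊢; omega
    · simp at hq hr h
      ext <;> omega
  simpa using this

lemma le_fejerWeight {N : ℕ} (hN : N ≠ 0) (l : ℤ) : 1 - |(l : ℝ)| / N ≤ fejerWeight N l := by
  have hN' : (0 : ℝ) < N := by positivity
  have : (Finset.range (N - l.natAbs)).card ≤
      ((Finset.range N ×ˢ Finset.range N).filter fun q => (q.1 : ℤ) - q.2 = l).card := by
    refine Finset.card_le_card_of_injOn
      (fun i => (i + l.toNat, i + (-l).toNat)) (fun i hi => ?_) (fun i hi j hj h => ?_)
    · simp at hi ⊢; omega
    · simp at h; omega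
  rw [Finset.card_range] at this
  have h2 : (N : ℝ) - |(l : ℝ)| ≤ ((N - l.natAbs : ℕ) : ℝ) := by
    rw [← Int.cast_abs, Int.abs_eq_natAbs, Int.cast_natCast]
    have : N ≤ (N - l.natAbs) + l.natAbs := by omega
    have : (N : ℝ) ≤ ((N - l.natAbs : ℕ) : ℝ) + l.natAbs := by exact_mod_cast this
    linarith
  unfold fejerWeight
  rw [le_div_iff₀ hN', sub_mul, div_mul_cancel₀ _ hN'.ne', one_mul]
  exact h2.trans (by exact_mod_cast this)

lemma tendsto_fejerWeight (l : ℤ) : Tendsto (fun N => fejerWeight N l) atTop (𝓝 1) := by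
  have h : Tendsto (fun N : ℕ => 1 - |(l : ℝ)| / N) atTop (𝓝 1) := by
    simpa using (tendsto_const_div_atTop_nhds_zero_nat |(l : ℝ)|).const_sub 1
  refine tendsto_of_tendsto_of_tendsto_of_le_of_le' h tendsto_const_nhds ?_
    (Eventually.of_forall fun N => fejerWeight_le_one N l)
  filter_upwards [eventually_ne_atTop 0] with N hN using le_fejerWeight hN l

lemma fejerWeight_eq_zero {N : ℕ} {l : ℤ} (h : l ∉ Finset.Ioo (-N : ℤ) N) :
    fejerWeight N l = 0 := by
  unfold fejerWeight
  rw [Finset.filter_eq_empty_iff.2]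
  · simp
  · intro q hq hl
    simp at hq h
    omega

section fejer
variable {E : Type*} [NormedAddCommGroup E] [NormedSpace ℂ E]

/-- The Fejér mean of order `N` of the formal series `∑ₗ Sₗ e^{ilt}`. -/
noncomputable def fejer (N : ℕ) (S : ℤ → E) (t : Torus) : E :=
  ∑ l ∈ Finset.Ioo (-N : ℤ) N, ((fejerWeight N l : ℂ) * fourier l t) • S l

lemma sum_range_range (N : ℕ) (f : ℤ → E) :
    ∑ k ∈ Finset.range N, ∑ j ∈ Finset.range N, f ((j : ℤ) - k)
      = (N : ℂ) • ∑ l ∈ Finset.Ioo (-N : ℤ) N, (fejerWeight N l : ℂ) • f l := by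
  rcases eq_or_ne N 0 with rfl | hN
  · simp
  have hN' : (N : ℂ) ≠ 0 := by exact_mod_cast hN
  rw [Finset.sum_comm, ← Finset.sum_product' (Finset.range N) (Finset.range N)
    (fun j k => f ((j : ℤ) - k)),
    ← Finset.sum_fiberwise_of_maps_to (t := Finset.Ioo (-N : ℤ) N)
      (g := fun q : ℕ × ℕ => (q.1 : ℤ) - q.2), Finset.smul_sum]
  · refine Finset.sum_congr rfl fun l _ => ?_
    rw [Finset.sum_congr rfl (g := fun _ => f l), Finset.sum_const, smul_smul,
      ← Nat.cast_smul_eq_nsmul ℂ]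
    · congr 1
      simp only [fejerWeight]
      push_cast
      field_simp
    · intro q hq
      rw [(Finset.mem_filter.1 hq).2]
  · intro q hq
    simp at hq ⊢
    omega

/-- This links Fejér means to matrices: the right side sums the `N × N` corner of the Toeplitz
matrix after twisting by phases. -/
lemma fejer_eq (N : ℕ) (S : ℤ → E) (t : Torus) :
    (N : ℂ) • fejer N S t = ∑ k ∈ Finset.range N, ∑ j ∈ Finset.range N,
      fourier ((j : ℤ) - k) t • S (j - k) := by
  rw [sum_range_range N (fun l => fourier l t • S l), fejer]
  simp [smul_smul]

lemma tendsto_fejer {S : ℤ → E} {s : Finset ℤ} (hS : ∀ l ∉ s, S l = 0) (t : Torus) :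
    Tendsto (fun N => fejer N S t) atTop (𝓝 (∑ l ∈ s, fourier l t • S l)) := by
  have h1 : Tendsto (fun N => ∑ l ∈ s, ((fejerWeight N l : ℂ) * fourier l t) • S l) atTop
      (𝓝 (∑ l ∈ s, fourier l t • S l)) := by
    refine tendsto_finsetSum _ fun l _ => ?_
    have h : Tendsto (fun N => (fejerWeight N l : ℂ)) atTop (𝓝 ((1 : ℝ) : ℂ)) :=
      (Complex.continuous_ofReal.tendsto _).comp (tendsto_fejerWeight l)
    simpa using (h.mul_const (fourier l t)).smul_const (S l)
  refine h1.congr fun N => ?_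
  classical
  rw [fejer, Finset.sum_subset (Finset.subset_union_left (s₁ := s) (s₂ := Finset.Ioo (-N : ℤ) N)),
    Finset.sum_subset (Finset.subset_union_right (s₁ := s) (s₂ := Finset.Ioo (-N : ℤ) N))]
  · intro l _ hl
    simp [fejerWeight_eq_zero hl]
  · intro l _ hl
    simp [hS l hl]

end fejer

/-! ### Bounded Toeplitz matrices and their Fejér means -/

omit [InnerProductSpace ℂ H] in
lemma tsum_enorm_sq (x : ℕ →₀ H) :
    ∑' j, ‖x j‖ₑ ^ 2 = ENNReal.ofReal (x.sum fun _ v => ‖v‖ ^ 2) := by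
  rw [tsum_eq_sum (s := x.support) (fun j hj => by simp [Finsupp.notMem_support_iff.1 hj]),
    Finsupp.sum, ENNReal.ofReal_sum_of_nonneg (fun _ _ => by positivity)]
  refine Finset.sum_congr rfl fun j _ => ?_
  rw [ENNReal.ofReal_pow (norm_nonneg _), ofReal_norm]

lemma boundedBy_iff (A : Matrix ℕ ℕ (H →L[ℂ] H)) (C : ℝ≥0) :
    BoundedBy A C ↔ ∀ (x : ℕ →₀ H) (K : ℕ),
      ∑ k ∈ Finset.range K, ‖mulVecCoord A x k‖ ^ 2 ≤ C ^ 2 * x.sum fun _ v => ‖v‖ ^ 2 := by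
  refine forall_congr' fun x => ?_
  have hx : 0 ≤ x.sum fun _ v => ‖v‖ ^ 2 := Finset.sum_nonneg fun _ _ => by positivity
  have hC : (C : ℝ≥0∞) ^ 2 * ∑' j, ‖x j‖ₑ ^ 2
      = ENNReal.ofReal (C ^ 2 * x.sum fun _ v => ‖v‖ ^ 2) := by
    rw [tsum_enorm_sq, ENNReal.ofReal_mul (by positivity), ENNReal.ofReal_pow (by positivity),
      ENNReal.ofReal_coe_nnreal]
  have hK : ∀ K, ∑ k ∈ Finset.range K, ‖mulVecCoord A x k‖ₑ ^ 2
      = ENNReal.ofReal (∑ k ∈ Finset.range K, ‖mulVecCoord A x k‖ ^ 2) := fun K => by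
    rw [ENNReal.ofReal_sum_of_nonneg (fun _ _ => by positivity)]
    refine Finset.sum_congr rfl fun j _ => ?_
    rw [ENNReal.ofReal_pow (norm_nonneg _), ofReal_norm]
  rw [hC, ENNReal.tsum_eq_iSup_nat, iSup_le_iff]
  refine forall_congr' fun K => ?_
  rw [hK, ENNReal.ofReal_le_ofReal_iff (by positivity)]

/-- Applying the matrix to `ξ = (e^{ijt} x)_{j<N}` and summing the output against the phases
`e^{-ikt}`, `k < N`, gives `N` times the Fejér mean at `x`. Cauchy–Schwarz costs `√N` and `‖ξ‖ = √N
‖x‖`, so the factors `N` cancel. -/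
lemma norm_fejer_le_of_boundedBy {S : ℤ → H →L[ℂ] H} {C : ℝ≥0} (h : BoundedBy (toeplitz S) C)
    (N : ℕ) (t : Torus) : ‖fejer N S t‖ ≤ C := by
  rcases Nat.eq_zero_or_pos N with rfl | hN
  · simp [fejer]
  have hN' : (0 : ℝ) < N := by exact_mod_cast hN
  refine ContinuousLinearMap.opNorm_le_bound _ C.2 fun x => ?_
  classical
  let ξ : ℕ →₀ H := ∑ j ∈ Finset.range N, Finsupp.single j (fourier (j : ℤ) t • x)
  have hξ : ∀ j, ξ j = if j < N then fourier (j : ℤ) t • x else 0 := by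
    intro j
    simp [ξ, Finsupp.finsetSum_apply, Finsupp.single_apply]
  have hcoord : ∀ k, mulVecCoord (toeplitz S) ξ k
      = ∑ j ∈ Finset.range N, fourier (j : ℤ) t • S (j - k) x := by
    intro k
    rw [mulVecCoord, Finsupp.sum_of_support_subset (s := Finset.range N)]
    · refine Finset.sum_congr rfl fun j hj => ?_
      rw [hξ, if_pos (Finset.mem_range.1 hj), map_smul, toeplitz]
    · intro j hj
      rw [Finsupp.mem_support_iff, hξ] at hj
      by_contra h'
      exact hj (if_neg (by simpa using h'))
    · simp
  have hnorm : ξ.sum (fun _ v => ‖v‖ ^ 2) = N * ‖x‖ ^ 2 := by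
    rw [Finsupp.sum_of_support_subset (s := Finset.range N)]
    · rw [Finset.sum_congr rfl (g := fun _ => ‖x‖ ^ 2)]
      · simp
      · intro j hj
        rw [hξ, if_pos (Finset.mem_range.1 hj), norm_smul, norm_fourier_apply, one_mul]
    · intro j hj
      rw [Finsupp.mem_support_iff, hξ] at hj
      by_contra h'
      exact hj (if_neg (by simpa using h'))
    · simp
  have h1 := (boundedBy_iff _ _).1 h ξ N
  rw [hnorm] at h1
  have h2 : (N : ℂ) • fejer N S t x
      = ∑ k ∈ Finset.range N, fourier (-(k : ℤ)) t • mulVecCoord (toeplitz S) ξ k := by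
    rw [← smul_apply, fejer_eq, sum_apply]
    refine Finset.sum_congr rfl fun k _ => ?_
    rw [sum_apply, hcoord, Finset.smul_sum]
    refine Finset.sum_congr rfl fun j _ => ?_
    rw [smul_apply, smul_smul, sub_eq_neg_add, fourier_add]
  have h3 : N * ‖fejer N S t x‖ ≤ ∑ k ∈ Finset.range N, ‖mulVecCoord (toeplitz S) ξ k‖ := by
    calc N * ‖fejer N S t x‖ = ‖(N : ℂ) • fejer N S t x‖ := by rw [norm_smul]; simp
      _ ≤ _ := by
        rw [h2]
        refine (norm_sum_le _ _).trans_eq (Finset.sum_congr rfl fun k _ => ?_)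
        rw [norm_smul, norm_fourier_apply, one_mul]
  have h4 : (∑ k ∈ Finset.range N, ‖mulVecCoord (toeplitz S) ξ k‖) ^ 2
      ≤ N * ∑ k ∈ Finset.range N, ‖mulVecCoord (toeplitz S) ξ k‖ ^ 2 := by
    simpa using sq_sum_le_card_mul_sum_sq (s := Finset.range N)
      (f := fun k => ‖mulVecCoord (toeplitz S) ξ k‖)
  have h5 : (N * ‖fejer N S t x‖) ^ 2 ≤ (N * (C * ‖x‖)) ^ 2 :=
    calc (N * ‖fejer N S t x‖) ^ 2 ≤ _ := pow_le_pow_left₀ (by positivity) h3 2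
      _ ≤ _ := h4
      _ ≤ N * (C ^ 2 * (N * ‖x‖ ^ 2)) := by gcongr
      _ = _ := by ring
  exact le_of_mul_le_mul_left (abs_le_of_sq_le_sq' h5 (by positivity)).2 hN'

/-- The matrix is a compression of pointwise multiplication by the symbol. Discrete Parseval on both
sides reduces the claim to the pointwise bound at the nodes. -/
lemma boundedBy_of_symbol {S : ℤ → H →L[ℂ] H} {s : Finset ℤ} (hS : ∀ l ∉ s, S l = 0) {C : ℝ≥0}
    (hC : ∀ t : Torus, ‖∑ l ∈ s, fourier l t • S l‖ ≤ C) : BoundedBy (toeplitz S) C := by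
  classical
  rw [boundedBy_iff]
  intro x K
  -- Indices are negated: `e^{ilt}` moves frequency `-j` to `l - j`, which is `-k` exactly when `l =
  -- j - k`.
  let X : ℤ →₀ H := ∑ j ∈ x.support, Finsupp.single (-(j : ℤ)) (x j)
  let Y : ℤ →₀ H := ∑ j ∈ x.support, ∑ l ∈ s, Finsupp.single (l - (j : ℤ)) (S l (x j))
  have hXY : ∀ t, vtrig Y t = (∑ l ∈ s, fourier l t • S l) (vtrig X t) := by
    intro t
    rw [vtrig_sum, vtrig_sum, map_sum]
    refine Finset.sum_congr rfl fun j _ => ?_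
    rw [vtrig_sum, vtrig_single, map_smul, sum_apply, Finset.smul_sum]
    refine Finset.sum_congr rfl fun l _ => ?_
    rw [vtrig_single, smul_apply, smul_smul, sub_eq_neg_add, fourier_add]
  have hYk : ∀ k : ℕ, Y (-(k : ℤ)) = mulVecCoord (toeplitz S) x k := by
    intro k
    rw [mulVecCoord, Finsupp.sum, Finsupp.finsetSum_apply]
    refine Finset.sum_congr rfl fun j _ => ?_
    rw [Finsupp.finsetSum_apply, toeplitz]
    by_cases hl : (j : ℤ) - k ∈ s
    · rw [Finset.sum_eq_single_of_mem _ hl]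
      · rw [show (j : ℤ) - k - j = -k by ring, Finsupp.single_eq_same]
      · intro l _ hne
        exact Finsupp.single_eq_of_ne (by omega)
    · rw [hS _ hl, zero_apply]
      refine Finset.sum_eq_zero fun l hl' => Finsupp.single_eq_of_ne ?_
      rintro h
      exact hl ((show (j : ℤ) - k = l by omega) ▸ hl')
  have hX : X.sum (fun _ v => ‖v‖ ^ 2) = x.sum fun _ v => ‖v‖ ^ 2 := by
    have hXj : ∀ j : ℕ, X (-(j : ℤ)) = x j := by
      intro j
      rw [Finsupp.finsetSum_apply]
      rw [Finset.sum_eq_single j]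
      · simp
      · intro i _ hne
        exact Finsupp.single_eq_of_ne (by omega)
      · intro h
        simpa using h
    rw [Finsupp.sum_of_support_subset (s := x.support.image fun j : ℕ => -(j : ℤ))]
    · rw [Finset.sum_image (by intro a _ b _ h; simpa using h)]
      exact Finset.sum_congr rfl fun j _ => by rw [hXj]
    · intro l hl
      rw [Finsupp.mem_support_iff, Finsupp.finsetSum_apply] at hl
      obtain ⟨j, hj, hne⟩ := Finset.exists_ne_zero_of_sum_ne_zero hl
      refine Finset.mem_image.2 ⟨j, hj, ?_⟩
      by_contra h
      exact hne (Finsupp.single_eq_of_ne (fun h' => h h'.symm))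
    · simp
  have hYK : ∑ k ∈ Finset.range K, ‖mulVecCoord (toeplitz S) x k‖ ^ 2
      ≤ Y.sum fun _ v => ‖v‖ ^ 2 := by
    simp only [← hYk]
    rw [← Finset.sum_image (f := fun l => ‖Y l‖ ^ 2) (g := fun k : ℕ => -(k : ℤ))
      (by intro a _ b _ h; simpa using h)]
    rw [Finsupp.sum]
    have : ∀ u : Finset ℤ, ∑ l ∈ u, ‖Y l‖ ^ 2 = ∑ l ∈ u with l ∈ Y.support, ‖Y l‖ ^ 2 := by
      intro u
      rw [Finset.sum_filter_of_ne]
      intro l _ hne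
      rw [Finsupp.mem_support_iff]
      rintro h
      simp [h] at hne
    rw [this]
    exact Finset.sum_le_sum_of_subset_of_nonneg (fun l hl => (Finset.mem_filter.1 hl).2)
      (fun _ _ _ => by positivity)
  refine hYK.trans ?_
  rw [← hX]
  obtain ⟨M, hM, hMX, hMY⟩ := ((eventually_gt_atTop 0).and
    ((sum_norm_sq_vtrig_node X).and (sum_norm_sq_vtrig_node Y))).exists
  have hM' : (0 : ℝ) < M := by exact_mod_cast hM
  refine le_of_mul_le_mul_left ?_ hM'
  rw [← hMY, mul_left_comm, ← hMX, Finset.mul_sum]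
  refine Finset.sum_le_sum fun m _ => ?_
  rw [← mul_pow, hXY]
  exact pow_le_pow_left₀ (norm_nonneg _) (ContinuousLinearMap.le_of_opNorm_le _ (hC _) _) 2

/-- Damping the entries by Fejér weights gives matrices with polynomial symbols, all bounded by `C`.
For finitely supported `x` and finitely many rows, the inequality survives the limit of the weights.
-/
lemma boundedBy_of_norm_fejer_le {S : ℤ → H →L[ℂ] H} {C : ℝ≥0}
    (h : ∀ N t, ‖fejer N S t‖ ≤ C) : BoundedBy (toeplitz S) C := by
  have hN : ∀ N : ℕ, BoundedBy (toeplitz fun l => (fejerWeight N l : ℂ) • S l) C := by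
    intro N
    refine boundedBy_of_symbol (s := Finset.Ioo (-N : ℤ) N)
      (fun l hl => by simp [fejerWeight_eq_zero hl]) fun t => ?_
    convert h N t using 2
    rw [fejer]
    refine Finset.sum_congr rfl fun l _ => ?_
    rw [smul_smul, mul_comm]
  rw [boundedBy_iff]
  intro x K
  refine le_of_tendsto' (x := atTop) ?_ fun N : ℕ => (boundedBy_iff _ _).1 (hN N) x K
  refine tendsto_finsetSum _ fun k _ => (Tendsto.norm ?_).pow 2
  refine tendsto_finsetSum _ fun j _ => ?_
  have h : Tendsto (fun N => (fejerWeight N ((j : ℤ) - k) : ℂ)) atTop (𝓝 ((1 : ℝ) : ℂ)) :=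
    (Complex.continuous_ofReal.tendsto _).comp (tendsto_fejerWeight _)
  simpa [toeplitz] using h.smul_const (S ((j : ℤ) - k) (x j))

/-- The infimum defining `opNorm` is not assumed to be attained, so the forward direction compares
with every `r > C`. -/
lemma opNorm_toeplitz_le_iff (S : ℤ → H →L[ℂ] H) (C : ℝ≥0) :
    opNorm (toeplitz S) ≤ C ↔ ∀ N t, ‖fejer N S t‖ ≤ C := by
  refine ⟨fun h N t => ?_, fun h => iInf₂_le C (boundedBy_of_norm_fejer_le h)⟩
  refine le_of_forall_gt_imp_ge_of_dense fun r hr => ?_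
  have h' : opNorm (toeplitz S) < (r.toNNReal : ℝ≥0∞) :=
    h.trans_lt (by
      rw [ENNReal.coe_lt_coe, ← NNReal.coe_lt_coe]
      exact hr.trans_le (Real.le_coe_toNNReal r))
  simp only [opNorm, iInf_lt_iff] at h'
  obtain ⟨D, hD, hlt⟩ := h'
  refine (norm_fejer_le_of_boundedBy hD N t).trans ?_
  have := ENNReal.coe_lt_coe.1 hlt
  rw [← NNReal.coe_lt_coe, Real.coe_toNNReal r (C.2.trans hr.le)] at this
  exact this.le

lemma isBoundedOp_toeplitz_iff (S : ℤ → H →L[ℂ] H) :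
    IsBoundedOp (toeplitz S) ↔ ∃ C : ℝ≥0, ∀ N t, ‖fejer N S t‖ ≤ C :=
  ⟨fun ⟨C, h⟩ => ⟨C, norm_fejer_le_of_boundedBy h⟩, fun ⟨C, h⟩ => ⟨C, boundedBy_of_norm_fejer_le h⟩⟩

lemma norm_coeff_le_of_norm_fejer_le {S : ℤ → H →L[ℂ] H} {C : ℝ≥0}
    (h : ∀ N t, ‖fejer N S t‖ ≤ C) (l : ℤ) : ‖S l‖ ≤ C := by
  classical
  refine ContinuousLinearMap.opNorm_le_bound _ C.2 fun v => ?_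
  -- `S l` sits in row `(-l).toNat` and column `l.toNat`; the `+ 1` includes that row in the partial
  -- sum.
  have h1 := (boundedBy_iff _ _).1 (boundedBy_of_norm_fejer_le h)
    (Finsupp.single l.toNat v) ((-l).toNat + 1)
  rw [Finsupp.sum_single_index (by simp)] at h1
  have h2 := (Finset.single_le_sum
    (f := fun k => ‖mulVecCoord (toeplitz S) (Finsupp.single l.toNat v) k‖ ^ 2)
    (fun _ _ => by positivity) (Finset.self_mem_range_succ (-l).toNat)).trans h1
  rw [mulVecCoord, Finsupp.sum_single_index (by simp), toeplitz,
    show (l.toNat : ℤ) - (-l).toNat = l by omega, ← mul_pow] at h2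
  exact (abs_le_of_sq_le_sq' h2 (by positivity)).2

lemma toeplitz_hadamard (S T : ℤ → H →L[ℂ] H) :
    toeplitz S ⊙ toeplitz T = toeplitz fun l => S l * T l := rfl

/-! ### Uniform boundedness of multipliers -/

/-- Right multiplication by the coefficients `Tₗ` maps series with Fejér means bounded by `D`
to series with Fejér means bounded by `C D`. -/
def IsFejerMultiplier (T : ℤ → H →L[ℂ] H) (C : ℝ≥0) : Prop :=
  ∀ (S : ℤ → H →L[ℂ] H) (D : ℝ≥0), (∀ N t, ‖fejer N S t‖ ≤ D) →
    ∀ N t, ‖fejer N (fun l => S l * T l) t‖ ≤ C * D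

lemma opNorm_toeplitz_lt_top_iff (S : ℤ → H →L[ℂ] H) :
    opNorm (toeplitz S) < ∞ ↔ IsBoundedOp (toeplitz S) := by
  simp only [opNorm, iInf_lt_iff, IsBoundedOp]
  exact ⟨fun ⟨C, h, _⟩ => ⟨C, h⟩, fun ⟨C, h⟩ => ⟨C, h, ENNReal.coe_lt_top⟩⟩

lemma isFejerMultiplier_iff (T : ℤ → H →L[ℂ] H) (C : ℝ≥0) :
    IsFejerMultiplier T C ↔
      ∀ B ∈ boundedToeplitz H, opNorm (B ⊙ toeplitz T) ≤ C * opNorm B := by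
  constructor
  · rintro h B ⟨hB, S, rfl⟩
    obtain ⟨D, hD, -⟩ := ENNReal.lt_iff_exists_coe.1 ((opNorm_toeplitz_lt_top_iff S).2 hB)
    rw [toeplitz_hadamard, hD, ← ENNReal.coe_mul, opNorm_toeplitz_le_iff]
    exact h S D ((opNorm_toeplitz_le_iff _ _).1 hD.le)
  · intro h S D hS
    have h1 := h (toeplitz S) ⟨(isBoundedOp_toeplitz_iff S).2 ⟨D, hS⟩, S, rfl⟩
    rw [toeplitz_hadamard] at h1
    have h2 : opNorm (toeplitz fun l => S l * T l) ≤ ((C * D : ℝ≥0) : ℝ≥0∞) := by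
      rw [ENNReal.coe_mul]
      exact h1.trans (by gcongr; exact (opNorm_toeplitz_le_iff _ _).2 hS)
    exact (opNorm_toeplitz_le_iff _ _).1 h2

lemma IsFejerMultiplier.isRightToeplitzMultiplier {T : ℤ → H →L[ℂ] H} {C : ℝ≥0}
    (h : IsFejerMultiplier T C) : IsRightToeplitzMultiplier (toeplitz T) := by
  rintro B ⟨hB, S, rfl⟩
  obtain ⟨D, hD⟩ := (isBoundedOp_toeplitz_iff S).1 hB
  rw [toeplitz_hadamard]
  exact ⟨(isBoundedOp_toeplitz_iff _).2 ⟨C * D, h S D hD⟩, _, rfl⟩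

lemma rightToeplitzMultiplierNorm_eq (T : ℤ → H →L[ℂ] H) :
    rightToeplitzMultiplierNorm (toeplitz T)
      = ⨅ (C : ℝ≥0) (_ : IsFejerMultiplier T C), (C : ℝ≥0∞) := by
  simp only [rightToeplitzMultiplierNorm, isFejerMultiplier_iff]

/-- The bounded Toeplitz matrices, as the closed subspace of the bounded families of operators
that consist of the Fejér means and the coefficients of a series. -/
noncomputable def fejerSpace (H : Type*) [NormedAddCommGroup H] [InnerProductSpace ℂ H] :
    Submodule ℂ (lp (fun _ : (ℕ × Torus) ⊕ ℤ => H →L[ℂ] H) ∞) where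
  carrier := {f | ∀ N t, f (Sum.inl (N, t)) = fejer N (fun l => f (Sum.inr l)) t}
  add_mem' {f g} hf hg N t := by
    rw [lp.coeFn_add, Pi.add_apply, hf, hg, fejer, fejer, fejer, ← Finset.sum_add_distrib]
    simp [smul_add]
  zero_mem' N t := by simp [fejer]
  smul_mem' c f hf N t := by
    rw [lp.coeFn_smul, Pi.smul_apply, hf, fejer, fejer, Finset.smul_sum]
    refine Finset.sum_congr rfl fun l _ => ?_
    rw [Pi.smul_apply, smul_comm]

lemma isClosed_fejerSpace :
    IsClosed (fejerSpace H : Set (lp (fun _ : (ℕ × Torus) ⊕ ℤ => H →L[ℂ] H) ∞)) := by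
  have hc : ∀ i, Continuous fun f : lp (fun _ : (ℕ × Torus) ⊕ ℤ => H →L[ℂ] H) ∞ => f i :=
    fun i => (lp.evalCLM ℂ (fun _ : (ℕ × Torus) ⊕ ℤ => H →L[ℂ] H) ∞ i).continuous
  have : (fejerSpace H : Set (lp (fun _ : (ℕ × Torus) ⊕ ℤ => H →L[ℂ] H) ∞))
      = ⋂ (N : ℕ) (t : Torus), {f | f (Sum.inl (N, t)) = fejer N (fun l => f (Sum.inr l)) t} := by
    ext f; simp only [Set.mem_iInter]; rfl
  rw [this]
  refine isClosed_iInter fun N => isClosed_iInter fun t => isClosed_eq (hc _) ?_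
  exact continuous_finsetSum _ fun l _ => (hc (Sum.inr l)).const_smul
    ((fejerWeight N l : ℂ) * fourier l t)

/-- Banach–Steinhaus on `fejerSpace`, complete as a closed subspace, for the maps taking a series to
a Fejér mean of its product with `T`. The multiplier hypothesis is exactly their pointwise
boundedness. -/
lemma exists_isFejerMultiplier [CompleteSpace H] {T : ℤ → H →L[ℂ] H}
    (h : IsRightToeplitzMultiplier (toeplitz T)) : ∃ C : ℝ≥0, IsFejerMultiplier T C := by
  have : CompleteSpace (fejerSpace H) := isClosed_fejerSpace.completeSpace_coe
  let g : ℕ × Torus → fejerSpace H →L[ℂ] (H →L[ℂ] H) := fun q =>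
    ∑ l ∈ Finset.Ioo (-q.1 : ℤ) q.1, ((fejerWeight q.1 l : ℂ) * fourier l q.2) •
      ((ContinuousLinearMap.mul ℂ (H →L[ℂ] H)).flip (T l) ∘L
        lp.evalCLM ℂ (fun _ : (ℕ × Torus) ⊕ ℤ => H →L[ℂ] H) ∞ (Sum.inr l) ∘L
          (fejerSpace H).subtypeL)
  have hg : ∀ q f, g q f = fejer q.1 (fun l => f.1 (Sum.inr l) * T l) q.2 := by
    intro q f
    simp only [g, fejer, sum_apply, smul_apply]
    rfl
  obtain ⟨C, hC⟩ := banach_steinhaus (g := g) (by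
    intro f
    have hf : ∀ N t, ‖fejer N (fun l => f.1 (Sum.inr l)) t‖ ≤ ‖f.1‖₊ := fun N t => by
      rw [← f.2 N t]
      exact lp.norm_apply_le_norm ENNReal.top_ne_zero f.1 _
    have h1 := h _ ⟨(isBoundedOp_toeplitz_iff _).2 ⟨_, hf⟩, _, rfl⟩
    rw [toeplitz_hadamard] at h1
    obtain ⟨D, hD⟩ := (isBoundedOp_toeplitz_iff _).1 h1.1
    exact ⟨D, fun q => by rw [hg]; exact hD _ _⟩)
  refine ⟨C.toNNReal, fun S D hS N t => ?_⟩
  have hmem : Memℓp (Sum.elim (fun q : ℕ × Torus => fejer q.1 S q.2) S :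
      (ℕ × Torus) ⊕ ℤ → H →L[ℂ] H) ∞ := by
    refine memℓp_infty ⟨D, ?_⟩
    rintro _ ⟨i | i, rfl⟩
    · exact hS _ _
    · exact norm_coeff_le_of_norm_fejer_le hS i
  let f : fejerSpace H := ⟨⟨_, hmem⟩, fun N t => rfl⟩
  have hf : ‖f‖ ≤ D := by
    refine lp.norm_le_of_forall_le D.2 ?_
    rintro (i | i)
    · exact hS _ _
    · exact norm_coeff_le_of_norm_fejer_le hS i
  have h1 := (g (N, t)).le_of_opNorm_le ((hC (N, t)).trans (Real.le_coe_toNNReal C)) f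
  rw [hg] at h1
  exact h1.trans (by gcongr)

/-! ### Summing maps on trigonometric polynomials -/

instance fact_two_pi_pos : Fact (0 < 2 * Real.pi) := ⟨Real.two_pi_pos⟩

/-- The trigonometric polynomial with given coefficients, as a continuous function. -/
noncomputable def trig : (ℤ →₀ ℂ) →ₗ[ℂ] C(Torus, ℂ) :=
  Finsupp.linearCombination ℂ fun l => fourier l

/-- The map `∑ₗ pₗ e^{ilt} ↦ ∑ₗ pₗ Tₗ` on trigonometric polynomials. -/
noncomputable def coeffMap {E : Type*} [NormedAddCommGroup E] [NormedSpace ℂ E] (T : ℤ → E) :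
    (ℤ →₀ ℂ) →ₗ[ℂ] E :=
  Finsupp.linearCombination ℂ T

lemma trig_apply (p : ℤ →₀ ℂ) (t : Torus) : trig p t = p.sum fun l c => c * fourier l t := by
  rw [trig, Finsupp.linearCombination_apply, Finsupp.sum, Finsupp.sum,
    ContinuousMap.coe_sum, Finset.sum_apply]
  rfl

lemma trig_single (l : ℤ) (c : ℂ) (t : Torus) : trig (Finsupp.single l c) t = c * fourier l t := by
  rw [trig_apply, Finsupp.sum_single_index (by simp)]

lemma coeffMap_apply {E : Type*} [NormedAddCommGroup E] [NormedSpace ℂ E] (T : ℤ → E)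
    (p : ℤ →₀ ℂ) : coeffMap T p = p.sum fun l c => c • T l := rfl

/-- The inequality `∑ᵢ ‖Ψ pᵢ‖ ≤ K sup_t ∑ᵢ |pᵢ(t)|` for finite families of trigonometric
polynomials. -/
def IsSumming {E : Type*} [NormedAddCommGroup E] [NormedSpace ℂ E] (Ψ : (ℤ →₀ ℂ) →ₗ[ℂ] E)
    (K : ℝ≥0) : Prop :=
  ∀ (s : Finset ℕ) (p : ℕ → ℤ →₀ ℂ) (D : ℝ≥0), (∀ t, ∑ i ∈ s, ‖trig (p i) t‖ ≤ D) →
    ∑ i ∈ s, ‖Ψ (p i)‖ ≤ K * D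

lemma coeffMap_clm_apply (T : ℤ → H →L[ℂ] H) (p : ℤ →₀ ℂ) (x : H) :
    coeffMap T p x = coeffMap (fun l => T l x) p := by
  rw [coeffMap_apply, coeffMap_apply, Finsupp.sum, sum_apply]
  rfl

/-- With `vᵢ = Ψ_x pᵢ` and `uᵢ` its normalisation, take the symbol `∑ᵢ pᵢ(t) ⟨uᵢ, ·⟩ x`, of norm at
most `D ‖x‖`. Multiplying its coefficients by `T`, evaluating at `t = 0` and applying to `x` returns
`(∑ᵢ ‖vᵢ‖) x`. -/
lemma IsFejerMultiplier.isSumming {T : ℤ → H →L[ℂ] H} {C : ℝ≥0} (h : IsFejerMultiplier T C)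
    (x : H) : IsSumming (coeffMap fun l => T l x) (C * ‖x‖₊) := by
  classical
  intro s p D hp
  rcases eq_or_ne x 0 with rfl | hx
  · simp [coeffMap_apply]
  set v : ℕ → H := fun i => coeffMap (fun l => T l x) (p i)
  -- Since `0⁻¹ = 0`, a vanishing `v i` gives `u i = 0`; only `‖u i‖ ≤ 1` is needed.
  let u : ℕ → H := fun i => ((‖v i‖⁻¹ : ℝ) : ℂ) • v i
  have hu : ∀ i, ‖u i‖ ≤ 1 := fun i => by
    rw [norm_smul, Complex.norm_real, norm_inv, norm_norm]
    exact inv_mul_le_one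
  have huv : ∀ i, inner ℂ (u i) (v i) = (‖v i‖ : ℂ) := fun i => by
    rw [inner_smul_left, inner_self_eq_norm_sq_to_K]
    rcases eq_or_ne (‖v i‖ : ℂ) 0 with h0 | h0
    · simp [h0]
    · rw [Complex.conj_ofReal, Complex.ofReal_inv]
      field_simp
      rfl
  let S : ℤ → H →L[ℂ] H := fun l => ∑ i ∈ s, p i l • InnerProductSpace.rankOne ℂ x (u i)
  let r : Finset ℤ := s.biUnion fun i => (p i).support
  have hr : ∀ i ∈ s, (p i).support ⊆ r := fun i hi =>
    Finset.subset_biUnion_of_mem (fun i => (p i).support) hi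
  have hS : ∀ l ∉ r, S l = 0 := by
    intro l hl
    refine Finset.sum_eq_zero fun i hi => ?_
    rw [Finsupp.notMem_support_iff.1 fun h' => hl (hr i hi h'), zero_smul]
  have htrig : ∀ i ∈ s, ∀ t, trig (p i) t = ∑ l ∈ r, p i l * fourier l t := by
    intro i hi t
    rw [trig_apply, Finsupp.sum_of_support_subset _ (hr i hi) _ (by simp)]
  have hsymb : ∀ t : Torus, ‖∑ l ∈ r, fourier l t • S l‖ ≤ (D * ‖x‖₊ : ℝ≥0) := by
    intro t
    have : ∑ l ∈ r, fourier l t • S l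
        = ∑ i ∈ s, trig (p i) t • InnerProductSpace.rankOne ℂ x (u i) := by
      simp only [S, Finset.smul_sum]
      rw [Finset.sum_comm]
      refine Finset.sum_congr rfl fun i hi => ?_
      rw [htrig i hi, Finset.sum_smul]
      refine Finset.sum_congr rfl fun l _ => ?_
      rw [smul_smul, mul_comm]
    rw [this, NNReal.coe_mul, coe_nnnorm]
    refine (norm_sum_le _ _).trans ((Finset.sum_le_sum fun i _ => ?_).trans
      ((Finset.sum_mul s (fun i => ‖trig (p i) t‖) ‖x‖).ge.trans
        (mul_le_mul_of_nonneg_right (hp t) (norm_nonneg x))))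
    rw [norm_smul, InnerProductSpace.norm_rankOne]
    exact mul_le_mul_of_nonneg_left (mul_le_of_le_one_right (norm_nonneg x) (hu i)) (norm_nonneg _)
  have h1 := h S _ (norm_fejer_le_of_boundedBy (boundedBy_of_symbol hS hsymb))
  -- The product symbol has finite support, so its value at `0` is the limit of its Fejér means and
  -- inherits their bound.
  have h2 := le_of_tendsto' (tendsto_fejer (S := fun l => S l * T l) (s := r)
    (fun l hl => by rw [hS l hl, zero_mul]) 0).norm fun N => h1 N 0
  have h3 : (∑ l ∈ r, fourier l (0 : Torus) • (S l * T l)) x = ((∑ i ∈ s, ‖v i‖ : ℝ) : ℂ) • x := by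
    rw [sum_apply, Complex.ofReal_sum, Finset.sum_smul]
    have : ∀ l ∈ r, (fourier l (0 : Torus) • (S l * T l)) x
        = ∑ i ∈ s, (p i l * inner ℂ (u i) (T l x)) • x := by
      intro l _
      rw [fourier_eval_zero, one_smul, show (S l * T l) x = S l (T l x) from rfl, sum_apply]
      refine Finset.sum_congr rfl fun i _ => ?_
      rw [smul_apply, InnerProductSpace.rankOne_apply, smul_smul]
    rw [Finset.sum_congr rfl this, Finset.sum_comm]
    refine Finset.sum_congr rfl fun i hi => ?_
    rw [← huv, ← Finset.sum_smul]
    congr 1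
    rw [show v i = coeffMap (fun l => T l x) (p i) from rfl, coeffMap_apply, Finsupp.sum_of_support_subset _ (hr i hi) _ (by simp), inner_sum]
    refine Finset.sum_congr rfl fun l _ => ?_
    rw [inner_smul_right]
  have h4 := ContinuousLinearMap.le_of_opNorm_le _ h2 x
  rw [h3, norm_smul, Complex.norm_real, Real.norm_of_nonneg (by positivity)] at h4
  have h5 := le_of_mul_le_mul_right h4 (norm_pos_iff.2 hx)
  refine h5.trans_eq ?_
  push_cast
  ring

/-! ### The dominating measure -/

/-- The Fejér kernel of order `n`, translated by `t_m` and divided by the number `2n` of nodes. -/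
noncomputable def fejerNode (n m : ℕ) : ℤ →₀ ℂ :=
  ∑ l ∈ Finset.Ioo (-n : ℤ) n,
    Finsupp.single l (fejerWeight n l * fourier (-l) (node (2 * n) m) / (2 * n : ℕ))

lemma trig_fejerNode (n m : ℕ) (t : Torus) : trig (fejerNode n m) t
    = fejer n (fun _ => (1 : ℂ)) (t - node (2 * n) m) / (2 * n : ℕ) := by
  rw [fejerNode, map_sum, ContinuousMap.coe_sum, Finset.sum_apply, fejer, Finset.sum_div]
  refine Finset.sum_congr rfl fun l _ => ?_
  rw [trig_single, smul_eq_mul, mul_one, sub_eq_add_neg]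
  have : fourier l (t + -node (2 * n) m) = fourier l t * fourier (-l) (node (2 * n) m) := by
    simp [fourier_apply, smul_add, AddCircle.toCircle_add]
  rw [this]
  ring

lemma fejer_one_nonneg (n : ℕ) (t : Torus) :
    ∃ r : ℝ, 0 ≤ r ∧ fejer n (fun _ => (1 : ℂ)) t = r := by
  rcases eq_or_ne n 0 with rfl | hn
  · exact ⟨0, le_rfl, by simp [fejer]⟩
  have hn' : (n : ℂ) ≠ 0 := by exact_mod_cast hn
  refine ⟨‖∑ j ∈ Finset.range n, fourier (j : ℤ) t‖ ^ 2 / n, by positivity, ?_⟩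
  have h := fejer_eq n (fun _ => (1 : ℂ)) t
  rw [Complex.ofReal_div, Complex.ofReal_natCast, eq_div_iff hn', mul_comm, ← smul_eq_mul, h,
    Complex.ofReal_pow, ← Complex.conj_mul', map_sum, Finset.sum_mul]
  refine Finset.sum_congr rfl fun k _ => ?_
  rw [Finset.mul_sum]
  refine Finset.sum_congr rfl fun j _ => ?_
  rw [← fourier_neg, ← fourier_add, smul_eq_mul, mul_one, sub_eq_neg_add]

/-- The kernels are nonnegative, so the norms can be dropped; summing over the nodes leaves only the
zero frequency. They form a partition of unity. -/
lemma sum_norm_trig_fejerNode {n : ℕ} (hn : n ≠ 0) (t : Torus) :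
    ∑ m ∈ Finset.range (2 * n), ‖trig (fejerNode n m) t‖ = 1 := by
  have hn' : (n : ℂ) ≠ 0 := by exact_mod_cast hn
  have hnorm : ∀ m, ((‖trig (fejerNode n m) t‖ : ℝ) : ℂ) = trig (fejerNode n m) t := by
    intro m
    obtain ⟨r, hr, h⟩ := fejer_one_nonneg n (t - node (2 * n) m)
    rw [trig_fejerNode, h, ← Complex.ofReal_natCast, ← Complex.ofReal_div, Complex.norm_real,
      Real.norm_of_nonneg (by positivity)]
  have : ((∑ m ∈ Finset.range (2 * n), ‖trig (fejerNode n m) t‖ : ℝ) : ℂ) = 1 := by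
    rw [Complex.ofReal_sum, Finset.sum_congr rfl fun m _ => hnorm m]
    simp only [fejerNode, map_sum, ContinuousMap.coe_sum, Finset.sum_apply, trig_single]
    rw [Finset.sum_comm, Finset.sum_eq_single 0]
    · have h0 : fejerWeight n 0 = 1 :=
        le_antisymm (fejerWeight_le_one n 0) (by simpa using le_fejerWeight hn 0)
      simp [h0]
      field_simp
    · intro l hl hl0
      rw [← Finset.sum_mul, ← Finset.sum_div, ← Finset.mul_sum, sum_fourier_node, if_neg (by omega)]
      · simp
      · simp at hl
        rw [abs_lt]
        push_cast
        omega
    · intro h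
      simp at h
      omega
  exact_mod_cast this

/-- The frequencies `k` and `l` are both smaller than `n` in size, so `|k - l| < 2n` and no aliasing
occurs; this is why `2n` nodes are used. -/
lemma sum_fourier_smul_fejerNode {n : ℕ} {k : ℤ} (hk : |k| < n) :
    ∑ m ∈ Finset.range (2 * n), fourier k (node (2 * n) m) • fejerNode n m
      = Finsupp.single k (fejerWeight n k : ℂ) := by
  have hn : n ≠ 0 := by have := abs_nonneg k; rintro rfl; simp at hk; omega
  have hn' : (n : ℂ) ≠ 0 := by exact_mod_cast hn
  rw [abs_lt] at hk
  simp only [fejerNode, Finset.smul_sum]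
  rw [Finset.sum_comm, Finset.sum_eq_single k]
  · rw [Finset.sum_congr rfl (g := fun _ => Finsupp.single k ((fejerWeight n k : ℂ) / (2 * n : ℕ)))]
    · rw [Finset.sum_const, Finset.card_range, Finsupp.smul_single]
      congr 1
      rw [nsmul_eq_mul]
      push_cast
      field_simp
    · intro m _
      rw [Finsupp.smul_single, smul_eq_mul, mul_div_assoc', mul_left_comm, ← fourier_add]
      simp
  · intro l hl hlk
    simp only [Finsupp.smul_single]
    rw [← Finsupp.single_finsetSum]
    have : ∀ m, fourier k (node (2 * n) m) • ((fejerWeight n l : ℂ) *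
        fourier (-l) (node (2 * n) m) / (2 * n : ℕ))
        = (fejerWeight n l / (2 * n : ℕ) : ℂ) * fourier (k + -l) (node (2 * n) m) := by
      intro m
      rw [fourier_add, smul_eq_mul]
      ring
    rw [Finset.sum_congr rfl fun m _ => this m, ← Finset.mul_sum, sum_fourier_node,
      if_neg (by omega), mul_zero, Finsupp.single_zero]
    simp at hl
    rw [abs_lt]
    push_cast
    omega
  · intro h
    simp at h
    omega

/-- Put mass `‖Ψ(F_{n,m})‖` at the `m`-th node, where `F_{n,m}` are the kernels `fejerNode n m`. As
these sum to `1`, the summing inequality bounds the total mass by `K`. The Fejér-damped `p` is `∑ₘ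
p(tₘ) F_{n,m}` for large `n`, so the triangle inequality gives the domination at level `n`; a weak
cluster point inherits it. -/
lemma IsSumming.exists_dominating_measure {E : Type*} [NormedAddCommGroup E] [NormedSpace ℂ E]
    {Ψ : (ℤ →₀ ℂ) →ₗ[ℂ] E} {K : ℝ≥0} (hΨ : IsSumming Ψ K) :
    ∃ ν : Measure Torus, IsFiniteMeasure ν ∧ ν Set.univ ≤ K ∧
      ∀ p, ‖Ψ p‖ ≤ ∫ t, ‖trig p t‖ ∂ν := by
  let ν : ℕ → FiniteMeasure Torus := fun n =>
    ⟨∑ m ∈ Finset.range (2 * n), ‖Ψ (fejerNode n m)‖₊ • Measure.dirac (node (2 * n) m),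
      inferInstance⟩
  have hint : ∀ (n : ℕ) (f : C(Torus, ℝ)), ∫ t, f t ∂(ν n : Measure Torus)
      = ∑ m ∈ Finset.range (2 * n), ‖Ψ (fejerNode n m)‖ * f (node (2 * n) m) := by
    intro n f
    simp only [ν, FiniteMeasure.toMeasure_mk]
    rw [integral_finsetSum_measure]
    · refine Finset.sum_congr rfl fun m _ => ?_
      rw [integral_smul_nnreal_measure, integral_dirac]
      rfl
    · intro m _
      exact (integrable_dirac (by simp)).smul_measure_nnreal
  have hmass : ∀ n, (ν n).mass ≤ K := by
    intro n
    have h1 := hΨ (Finset.range (2 * n)) (fejerNode n) 1 fun t => by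
      rcases eq_or_ne n 0 with rfl | hn
      · simp
      · exact (sum_norm_trig_fejerNode hn t).le
    have h2 : ((ν n : Measure Torus) Set.univ) = ((∑ m ∈ Finset.range (2 * n),
        ‖Ψ (fejerNode n m)‖₊ : ℝ≥0) : ℝ≥0∞) := by
      simp only [ν, FiniteMeasure.toMeasure_mk, Measure.finsetSum_apply, Measure.smul_apply,
        measure_univ, ENNReal.smul_def, smul_eq_mul, mul_one, ENNReal.ofNNReal_finsetSum]
    rw [← ENNReal.coe_le_coe, FiniteMeasure.ennreal_mass, h2, ENNReal.coe_le_coe,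
      ← NNReal.coe_le_coe]
    push_cast
    simpa using h1
  obtain ⟨μ, hμ, hcl⟩ := (isCompact_setOfPred_finiteMeasure_le_of_compactSpace Torus K
    ).exists_mapClusterPt (f := atTop) (u := ν) (tendsto_principal.2 (Eventually.of_forall hmass))
  obtain ⟨U, hU, hlim⟩ := mapClusterPt_iff_ultrafilter.1 hcl
  refine ⟨μ, inferInstance, ?_, fun p => ?_⟩
  · rw [← FiniteMeasure.ennreal_mass]
    exact ENNReal.coe_le_coe.2 hμ
  let f : C(Torus, ℝ) := ⟨fun t => ‖trig p t‖, (trig p).continuous.norm⟩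
  have h1 := (FiniteMeasure.tendsto_iff_forall_integral_tendsto.1 hlim)
    (BoundedContinuousFunction.mkOfCompact f)
  have h2 : Tendsto (fun n : ℕ => Ψ (p.sum fun l c => c • Finsupp.single l (fejerWeight n l : ℂ)))
      atTop (𝓝 (Ψ p)) := by
    have : Ψ p = ∑ l ∈ p.support, (p l * ((1 : ℝ) : ℂ)) • Ψ (Finsupp.single l 1) := by
      conv_lhs => rw [← Finsupp.sum_single p]
      rw [Finsupp.sum, map_sum]
      refine Finset.sum_congr rfl fun l _ => ?_
      rw [← map_smul, Finsupp.smul_single]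
      simp
    rw [this]
    simp only [Finsupp.sum, map_sum]
    refine tendsto_finsetSum _ fun l _ => ?_
    have h : Tendsto (fun N => (fejerWeight N l : ℂ)) atTop (𝓝 ((1 : ℝ) : ℂ)) :=
      (Complex.continuous_ofReal.tendsto _).comp (tendsto_fejerWeight _)
    refine ((h.const_mul (p l)).smul_const _).congr fun n => ?_
    rw [← map_smul]
    simp
  refine le_of_tendsto_of_tendsto (h2.norm.mono_left hU) h1 ?_
  refine hU ?_
  obtain ⟨R, hR⟩ : ∃ R : ℕ, ∀ l ∈ p.support, |l| < R := by
    refine ⟨(∑ a ∈ p.support, |a|).toNat + 1, fun a ha => ?_⟩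
    have h1 : |a| ≤ ∑ a ∈ p.support, |a| :=
      Finset.single_le_sum (f := fun b : ℤ => |b|) (fun _ _ => abs_nonneg _) ha
    omega
  filter_upwards [eventually_ge_atTop R] with n hn
  have h3 : (p.sum fun l c => c • Finsupp.single l (fejerWeight n l : ℂ))
      = ∑ m ∈ Finset.range (2 * n), trig p (node (2 * n) m) • fejerNode n m := by
    simp only [trig_apply, Finsupp.sum, Finset.sum_smul]
    rw [Finset.sum_comm]
    refine Finset.sum_congr rfl fun l hl => ?_
    rw [← sum_fourier_smul_fejerNode ((hR l hl).trans_le (by exact_mod_cast hn)), Finset.smul_sum]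
    simp only [smul_smul]
  rw [h3, map_sum]
  refine (norm_sum_le _ _).trans_eq ?_
  rw [show ∫ t, BoundedContinuousFunction.mkOfCompact f t ∂(ν n : Measure Torus)
    = ∫ t, f t ∂(ν n : Measure Torus) from rfl, hint]
  refine Finset.sum_congr rfl fun m _ => ?_
  rw [map_smul, norm_smul, mul_comm]
  rfl

/-! ### Integration of operator-valued functions against `μ_x` -/

lemma exists_simpleFunc_norm_sub_le (f : C(Torus, ℂ)) {δ : ℝ} (hδ : 0 < δ) :
    ∃ s : SimpleFunc Torus ℂ, ∀ t, ‖s t - f t‖ ≤ δ := by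
  let e := TopologicalSpace.denseSeq ℂ
  have hcover : Set.range f ⊆ ⋃ n, Metric.ball (e n) δ := by
    intro z _
    obtain ⟨n, hn⟩ := (TopologicalSpace.denseRange_denseSeq ℂ).exists_dist_lt z hδ
    exact Set.mem_iUnion.2 ⟨n, hn⟩
  obtain ⟨F, hF⟩ := (isCompact_range f.continuous).elim_finite_subcover _
    (fun n => Metric.isOpen_ball) hcover
  refine ⟨(SimpleFunc.nearestPt e (F.sup id)).comp f f.continuous.measurable, fun t => ?_⟩
  obtain ⟨n, hn, hlt⟩ := Set.mem_iUnion₂.1 (hF ⟨t, rfl⟩)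
  have h1 := SimpleFunc.edist_nearestPt_le e (f t) (Finset.le_sup (f := id) hn)
  rw [← dist_eq_norm]
  rw [edist_dist, edist_dist, ENNReal.ofReal_le_ofReal_iff dist_nonneg] at h1
  exact h1.trans (by rw [dist_comm]; exact (Metric.mem_ball.1 hlt).le)

/-- The evaluation pairing `(A, v) ↦ A v`. -/
noncomputable def evalPairing (H : Type*) [NormedAddCommGroup H] [InnerProductSpace ℂ H] :
    (H →L[ℂ] H) →L[ℝ] H →L[ℝ] H :=
  ContinuousLinearMap.restrictScalarsL ℂ H H ℝ ℝ

lemma evalPairing_apply (A : H →L[ℂ] H) (v : H) : evalPairing H A v = A v := rfl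

lemma norm_evalPairing_le : ‖evalPairing H‖ ≤ 1 :=
  ContinuousLinearMap.opNorm_le_bound _ zero_le_one fun A => by
    rw [one_mul]
    exact ContinuousLinearMap.opNorm_le_bound _ (norm_nonneg A) fun v => A.le_opNorm v

/-- The integral `∫ F(t) d(μ_x)(t)` of an operator-valued function. -/
noncomputable def opIntegral (μ : VectorMeasure Torus (H →L[ℂ] H)) (x : H)
    (F : Torus → H →L[ℂ] H) : H :=
  (applyMeasure μ x).integral F (evalPairing H)

lemma applyMeasure_apply (μ : VectorMeasure Torus (H →L[ℂ] H)) (x : H) (s : Set Torus) :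
    applyMeasure μ x s = μ s x := rfl

section opIntegral

variable (μ : VectorMeasure Torus (H →L[ℂ] H)) (x : H)

lemma norm_opIntegral_le (F : Torus → H →L[ℂ] H) :
    ‖opIntegral μ x F‖ ≤ ∫ t, ‖F t‖ ∂(applyMeasure μ x).variation :=
  (VectorMeasure.norm_integral_le_integral_norm).trans
    (mul_le_of_le_one_left (integral_nonneg fun _ => norm_nonneg _) norm_evalPairing_le)

variable [IsFiniteMeasure (applyMeasure μ x).variation]

lemma opIntegral_indicator [CompleteSpace H] {s : Set Torus} (hs : MeasurableSet s)
    (A : H →L[ℂ] H) : opIntegral μ x (s.indicator fun _ => A) = A (μ s x) := by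
  rw [opIntegral, VectorMeasure.integral_indicator hs, VectorMeasure.integral_const,
    evalPairing_apply, VectorMeasure.restrict_apply _ hs MeasurableSet.univ, Set.univ_inter,
    applyMeasure_apply]

lemma integrable_indicator_clm {s : Set Torus} (hs : MeasurableSet s) (A : H →L[ℂ] H) :
    Integrable (s.indicator fun _ => A) (applyMeasure μ x).variation :=
  (integrable_const A).indicator hs

lemma smul_eq_sum_indicator (s : SimpleFunc Torus ℂ) (A : H →L[ℂ] H) :
    (fun t => s t • A) = fun t => ∑ c ∈ s.range, (s ⁻¹' {c}).indicator (fun _ => c • A) t := by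
  classical
  funext t
  rw [Finset.sum_eq_single_of_mem (s t) (SimpleFunc.mem_range_self s t)]
  · rw [Set.indicator_of_mem (show t ∈ s ⁻¹' {s t} from rfl)]
  · intro c _ hc
    exact Set.indicator_of_notMem (fun h => hc h.symm) _

lemma integrable_simpleFunc_smul (s : SimpleFunc Torus ℂ) (A : H →L[ℂ] H) :
    Integrable (fun t => s t • A) (applyMeasure μ x).variation :=
  s.integrable_of_isFiniteMeasure.smul_const A

lemma integrable_continuous_smul (f : C(Torus, ℂ)) (A : H →L[ℂ] H) :
    Integrable (fun t => f t • A) (applyMeasure μ x).variation :=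
  (f.continuous.integrable_of_hasCompactSupport
    (HasCompactSupport.of_compactSpace _)).smul_const A

lemma opIntegral_simpleFunc_smul [CompleteSpace H] (s : SimpleFunc Torus ℂ) (A : H →L[ℂ] H) :
    opIntegral μ x (fun t => s t • A) = A (simpleIntegral μ s x) := by
  rw [smul_eq_sum_indicator, opIntegral, VectorMeasure.integral_finsetSum _ fun c _ =>
    integrable_indicator_clm μ x (s.measurableSet_fiber c) _]
  rw [simpleIntegral, sum_apply, map_sum]
  refine Finset.sum_congr rfl fun c _ => ?_
  rw [← opIntegral, opIntegral_indicator μ x (s.measurableSet_fiber c), smul_apply, smul_apply,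
    map_smul]

lemma opIntegral_smul_of_hasIntegral [CompleteSpace H] {f : C(Torus, ℂ)} {I : H →L[ℂ] H}
    (h : HasIntegral μ f I) (A : H →L[ℂ] H) : opIntegral μ x (fun t => f t • A) = A (I x) := by
  refine eq_of_forall_dist_le fun ε hε => ?_
  set V := (applyMeasure μ x).variation.real Set.univ with hV
  have hV0 : 0 ≤ V := measureReal_nonneg
  -- The two errors below add up to `(ε / M) * (M - 1)`; the `+ 1` keeps `M` positive.
  set M := ‖A‖ * V + ‖A‖ * ‖x‖ + 1 with hM
  have hM0 : 0 < M := by positivity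
  obtain ⟨δ, hδ, hs⟩ := h (ε / M) (by positivity)
  obtain ⟨s, hsf⟩ := exists_simpleFunc_norm_sub_le f (lt_min hδ (div_pos hε hM0))
  have h1 := hs s fun t => (hsf t).trans (min_le_left _ _)
  have h2 : ‖opIntegral μ x (fun t => f t • A) - opIntegral μ x (fun t => s t • A)‖
      ≤ (ε / M) * ‖A‖ * V := by
    rw [opIntegral, opIntegral, ← VectorMeasure.integral_fun_sub
      (integrable_continuous_smul μ x f A) (integrable_simpleFunc_smul μ x s A), ← opIntegral]
    refine (norm_opIntegral_le _ _ _).trans ?_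
    have : ∫ t, ‖f t • A - s t • A‖ ∂(applyMeasure μ x).variation
        ≤ ∫ _, (ε / M) * ‖A‖ ∂(applyMeasure μ x).variation := by
      refine integral_mono_of_nonneg (Eventually.of_forall fun _ => norm_nonneg _)
        (integrable_const _) (Eventually.of_forall fun t => ?_)
      simp only
      rw [← sub_smul, norm_smul, norm_sub_rev]
      exact mul_le_mul_of_nonneg_right ((hsf t).trans (min_le_right _ _)) (norm_nonneg _)
    refine this.trans_eq ?_
    rw [integral_const, smul_eq_mul, mul_comm]
  have h3 : ‖opIntegral μ x (fun t => s t • A) - A (I x)‖ ≤ ‖A‖ * ((ε / M) * ‖x‖) := by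
    rw [opIntegral_simpleFunc_smul, ← map_sub, ← sub_apply]
    exact (A.le_opNorm _).trans (mul_le_mul_of_nonneg_left
      (ContinuousLinearMap.le_of_opNorm_le _ h1 x) (norm_nonneg _))
  rw [dist_eq_norm]
  calc ‖opIntegral μ x (fun t => f t • A) - A (I x)‖
      ≤ (ε / M) * ‖A‖ * V + ‖A‖ * ((ε / M) * ‖x‖) :=
        (norm_sub_le_norm_sub_add_norm_sub _ _ _).trans (add_le_add h2 h3)
    _ = (ε / M) * (M - 1) := by rw [hM]; ring
    _ ≤ (ε / M) * M := by gcongr; linarith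
    _ = ε := div_mul_cancel₀ _ hM0.ne'

end opIntegral

section coefficients

variable {μ : VectorMeasure Torus (H →L[ℂ] H)} {T : ℤ → H →L[ℂ] H} [CompleteSpace H]

lemma opIntegral_fourier_smul (hT : ∀ l, HasFourierCoeff μ l (T (-l))) (x : H)
    [IsFiniteMeasure (applyMeasure μ x).variation] (l : ℤ) (A : H →L[ℂ] H) :
    opIntegral μ x (fun t => fourier l t • A) = A (T l x) := by
  have h := hT (-l)
  rw [neg_neg] at h
  refine opIntegral_smul_of_hasIntegral μ x (f := fourier l) ?_ A
  simpa only [HasFourierCoeff, neg_neg] using h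

/-- Multiplying coefficients is convolving with `μ_x`: each `Tₗ x` is the integral of `e^{ils}`, and
its phase joins that of `t`. -/
lemma fejer_mul_apply (hT : ∀ l, HasFourierCoeff μ l (T (-l))) (x : H)
    [IsFiniteMeasure (applyMeasure μ x).variation] (S : ℤ → H →L[ℂ] H) (N : ℕ) (t : Torus) :
    fejer N (fun l => S l * T l) t x = opIntegral μ x fun s => fejer N S (t + s) := by
  have h : (fun s => fejer N S (t + s)) = fun s => ∑ l ∈ Finset.Ioo (-N : ℤ) N,
      fourier l s • (((fejerWeight N l : ℂ) * fourier l t) • S l) := by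
    funext s
    refine Finset.sum_congr rfl fun l _ => ?_
    have : fourier l (t + s) = fourier l t * fourier l s := by
      simp [fourier_apply, smul_add, AddCircle.toCircle_add]
    rw [this, smul_smul]
    congr 1
    ring
  rw [h, opIntegral, VectorMeasure.integral_finsetSum _ fun l _ =>
    integrable_continuous_smul μ x (fourier l) _, fejer, sum_apply]
  refine Finset.sum_congr rfl fun l _ => ?_
  rw [← opIntegral, opIntegral_fourier_smul hT, smul_apply, smul_apply]
  rfl

lemma norm_fejer_mul_apply_le (hT : ∀ l, HasFourierCoeff μ l (T (-l))) (x : H)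
    [IsFiniteMeasure (applyMeasure μ x).variation] {S : ℤ → H →L[ℂ] H} {D : ℝ≥0}
    (hS : ∀ N t, ‖fejer N S t‖ ≤ D) (N : ℕ) (t : Torus) :
    ‖fejer N (fun l => S l * T l) t x‖ ≤ D * (applyMeasure μ x).variation.real Set.univ := by
  rw [fejer_mul_apply hT]
  refine (norm_opIntegral_le _ _ _).trans ((integral_mono_of_nonneg
    (Eventually.of_forall fun _ => norm_nonneg _) (integrable_const (D : ℝ))
    (Eventually.of_forall fun s => hS N (t + s))).trans_eq ?_)
  rw [integral_const, smul_eq_mul, mul_comm]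

/-- Both vectors are integrals against `μ_x` of scalar functions times the identity. This estimate
later identifies `μ(s) x` as the value at an indicator of the extension of `Ψ_x`. -/
lemma norm_coeffMap_sub_le (hT : ∀ l, HasFourierCoeff μ l (T (-l))) (x : H)
    [IsFiniteMeasure (applyMeasure μ x).variation] {s : Set Torus} (hs : MeasurableSet s)
    (p : ℤ →₀ ℂ) : ‖coeffMap (fun l => T l x) p - μ s x‖
      ≤ ∫ t, ‖trig p t - s.indicator (fun _ => 1) t‖ ∂(applyMeasure μ x).variation := by
  have h1 : opIntegral μ x (fun t => trig p t • (1 : H →L[ℂ] H))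
      = coeffMap (fun l => T l x) p := by
    have : (fun t => trig p t • (1 : H →L[ℂ] H))
        = fun t => ∑ l ∈ p.support, fourier l t • (p l • (1 : H →L[ℂ] H)) := by
      funext t
      rw [trig_apply, Finsupp.sum, Finset.sum_smul]
      refine Finset.sum_congr rfl fun l _ => ?_
      rw [smul_smul, mul_comm]
    rw [this, opIntegral, VectorMeasure.integral_finsetSum _ fun l _ =>
      integrable_continuous_smul μ x (fourier l) _, coeffMap_apply]
    refine Finset.sum_congr rfl fun l _ => ?_
    rw [← opIntegral, opIntegral_fourier_smul hT]
    rfl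
  have h2 := opIntegral_indicator μ x hs (1 : H →L[ℂ] H)
  rw [← h1, show μ s x = (1 : H →L[ℂ] H) (μ s x) from rfl, ← h2, opIntegral, opIntegral,
    ← VectorMeasure.integral_fun_sub (integrable_continuous_smul μ x _ _)
      (integrable_indicator_clm μ x hs _), ← opIntegral]
  refine (norm_opIntegral_le _ _ _).trans (integral_mono_of_nonneg
    (Eventually.of_forall fun _ => norm_nonneg _) ?_ (Eventually.of_forall fun t => ?_))
  · exact (((trig p).continuous.integrable_of_hasCompactSupport
      (HasCompactSupport.of_compactSpace _)).sub ((integrable_const (1 : ℂ)).indicator hs)).norm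
  · have : s.indicator (fun _ => (1 : H →L[ℂ] H)) t
        = s.indicator (fun _ => (1 : ℂ)) t • (1 : H →L[ℂ] H) := by
      by_cases ht : t ∈ s <;> simp [ht]
    simp only
    rw [this, ← sub_smul, norm_smul]
    exact mul_le_of_le_one_right (norm_nonneg _) ContinuousLinearMap.norm_id_le

end coefficients

/-! ### The norm of `M_SOT` -/

lemma variation_applyMeasure_smul (μ : VectorMeasure Torus (H →L[ℂ] H)) (c : ℂ) (x : H) :
    (applyMeasure μ (c • x)).variation Set.univ
      = ‖c‖ₑ * (applyMeasure μ x).variation Set.univ := by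
  have : applyMeasure μ (c • x) = c • applyMeasure μ x := by
    ext s _
    simp [applyMeasure_apply]
  rw [this, VectorMeasure.variation_smul]
  rfl

/-- Homogeneity in `x`. For `H = 0` the supremum is empty, and the zero vector is handled
separately. -/
lemma sotNorm_le_iff (μ : VectorMeasure Torus (H →L[ℂ] H)) (C : ℝ≥0∞) :
    sotNorm μ ≤ C ↔ ∀ x, (applyMeasure μ x).variation Set.univ ≤ C * ‖x‖ₑ := by
  rw [sotNorm, iSup₂_le_iff]
  constructor
  · intro h x
    rcases eq_or_ne x 0 with rfl | hx
    · have := variation_applyMeasure_smul μ 0 (0 : H)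
      simp at this
      simp [this]
    · have hx' : ‖x‖ ≠ 0 := norm_ne_zero_iff.2 hx
      have h1 := h (((‖x‖⁻¹ : ℝ) : ℂ) • x) (by
        rw [norm_smul, Complex.norm_real, norm_inv, norm_norm, inv_mul_cancel₀ hx'])
      have h2 : x = (‖x‖ : ℂ) • (((‖x‖⁻¹ : ℝ) : ℂ) • x) := by
        rw [smul_smul, ← Complex.ofReal_mul, mul_inv_cancel₀ hx', Complex.ofReal_one, one_smul]
      conv_lhs => rw [h2, variation_applyMeasure_smul]
      rw [mul_comm]
      refine mul_le_mul' h1 (le_of_eq ?_)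
      rw [← ofReal_norm, ← ofReal_norm, Complex.norm_real, norm_norm]
  · intro h x hx
    refine (h x).trans_eq ?_
    rw [← ofReal_norm, hx, ENNReal.ofReal_one, mul_one]

/-- Banach–Steinhaus for the functionals `x ↦ ∑ ⟨u_s, μ(s) x⟩` over finite disjoint families and
vectors `u_s` in the unit ball. Each is bounded at `x` by `|μ_x|(𝕋)`, and choosing `u_s` along `μ(s)
x` recovers the variation. -/
lemma sotNorm_lt_top [CompleteSpace H] {μ : VectorMeasure Torus (H →L[ℂ] H)}
    (h : ∀ x, (applyMeasure μ x).variation Set.univ < ∞) : sotNorm μ < ∞ := by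
  classical
  let ι := {q : Finset (Set Torus) × (Set Torus → H) //
    (q.1 : Set (Set Torus)).PairwiseDisjoint id ∧ ∀ s, ‖q.2 s‖ ≤ 1}
  let g : ι → H →L[ℂ] ℂ := fun q => ∑ s ∈ q.1.1, innerSL ℂ (q.1.2 s) ∘L μ s
  have hg : ∀ q x, g q x = ∑ s ∈ q.1.1, inner ℂ (q.1.2 s) (μ s x) := by
    intro q x
    simp [g, sum_apply]
  obtain ⟨C, hC⟩ := banach_steinhaus (g := g) (by
    intro x
    refine ⟨((applyMeasure μ x).variation Set.univ).toReal, fun q => ?_⟩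
    have h1 := VectorMeasure.le_variation (applyMeasure μ x) MeasurableSet.univ
      (P := q.1.1) (fun _ _ => Set.subset_univ _) q.2.1
    have h2 := ENNReal.toReal_mono (h x).ne h1
    rw [ENNReal.toReal_sum (by simp)] at h2
    rw [hg]
    refine (norm_sum_le _ _).trans (le_trans (Finset.sum_le_sum fun s _ => ?_) h2)
    rw [toReal_enorm]
    exact (norm_inner_le_norm _ _).trans (mul_le_of_le_one_left (norm_nonneg _) (q.2.2 s)))
  have hC0 : (C.toNNReal : ℝ≥0∞) < ∞ := ENNReal.coe_lt_top
  refine lt_of_le_of_lt ((sotNorm_le_iff μ _).2 fun x => ?_) hC0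
  by_contra! hlt
  obtain ⟨P, -, hP, -, hsum⟩ :=
    VectorMeasure.exists_lt_sum_of_lt_variation (applyMeasure μ x) MeasurableSet.univ hlt
  let u : Set Torus → H := fun s => ((‖μ s x‖⁻¹ : ℝ) : ℂ) • μ s x
  have hu : ∀ s, ‖u s‖ ≤ 1 := fun s => by
    rw [norm_smul, Complex.norm_real, norm_inv, norm_norm]
    exact inv_mul_le_one
  have huv : ∀ s, inner ℂ (u s) (μ s x) = (‖μ s x‖ : ℂ) := fun s => by
    rw [inner_smul_left, inner_self_eq_norm_sq_to_K]
    rcases eq_or_ne (‖μ s x‖ : ℂ) 0 with h0 | h0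
    · simp [h0]
    · rw [Complex.conj_ofReal, Complex.ofReal_inv]
      field_simp
      rfl
  have h1 := (g ⟨(P, u), hP, hu⟩).le_of_opNorm_le
    ((hC ⟨(P, u), hP, hu⟩).trans (Real.le_coe_toNNReal C)) x
  rw [hg] at h1
  simp only [huv] at h1
  rw [← Complex.ofReal_sum, Complex.norm_real, Real.norm_of_nonneg (by positivity)] at h1
  refine hsum.not_ge ?_
  have h2 : ∑ s ∈ P, ‖applyMeasure μ x s‖ₑ = ENNReal.ofReal (∑ s ∈ P, ‖μ s x‖) := by
    rw [ENNReal.ofReal_sum_of_nonneg fun _ _ => norm_nonneg _]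
    exact Finset.sum_congr rfl fun s _ => (ofReal_norm _).symm
  rw [h2]
  refine (ENNReal.ofReal_le_ofReal h1).trans_eq ?_
  rw [ENNReal.ofReal_mul (NNReal.coe_nonneg _), ENNReal.ofReal_coe_nnreal, ofReal_norm]

lemma isFejerMultiplier_of_sotNorm_le [CompleteSpace H] {μ : VectorMeasure Torus (H →L[ℂ] H)}
    {T : ℤ → H →L[ℂ] H} (hT : ∀ l, HasFourierCoeff μ l (T (-l))) {C : ℝ≥0}
    (hC : sotNorm μ ≤ C) : IsFejerMultiplier T C := by
  intro S D hS N t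
  refine ContinuousLinearMap.opNorm_le_bound _ (by positivity) fun x => ?_
  have h1 := (sotNorm_le_iff μ C).1 hC x
  have : IsFiniteMeasure (applyMeasure μ x).variation :=
    ⟨h1.trans_lt (ENNReal.mul_lt_top ENNReal.coe_lt_top enorm_lt_top)⟩
  refine (norm_fejer_mul_apply_le hT x hS N t).trans ?_
  have h2 : (applyMeasure μ x).variation.real Set.univ ≤ C * ‖x‖ := by
    have := ENNReal.toReal_mono (ENNReal.mul_ne_top ENNReal.coe_ne_top enorm_ne_top) h1
    simpa [ENNReal.toReal_mul, measureReal_def] using this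
  calc (D : ℝ) * (applyMeasure μ x).variation.real Set.univ ≤ D * (C * ‖x‖) := by gcongr
    _ = _ := by ring

/-! ### Extension of dominated maps from trigonometric polynomials to integrable functions -/

lemma exists_norm_trig_sub_le (f : C(Torus, ℂ)) {ε : ℝ} (hε : 0 < ε) :
    ∃ p, ∀ t, ‖trig p t - f t‖ ≤ ε := by
  have h : f ∈ (Submodule.span ℂ (Set.range (@fourier (2 * Real.pi)))).topologicalClosure := by
    rw [span_fourier_closure_eq_top]; trivial
  obtain ⟨g, hg, hlt⟩ := Metric.mem_closure_iff.1 h ε hε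
  rw [SetLike.mem_coe, ← Finsupp.range_linearCombination] at hg
  obtain ⟨p, rfl⟩ := hg
  refine ⟨p, fun t => ?_⟩
  rw [← dist_eq_norm, dist_comm]
  exact (ContinuousMap.dist_apply_le_dist t).trans hlt.le

lemma integrable_trig (ν : Measure Torus) [IsFiniteMeasure ν] (p : ℤ →₀ ℂ) :
    Integrable (trig p) ν :=
  (trig p).continuous.integrable_of_hasCompactSupport (HasCompactSupport.of_compactSpace _)

lemma integrable_norm_trig_sub {ν : Measure Torus} [IsFiniteMeasure ν] {f : Torus → ℂ}
    (hf : Integrable f ν) (p : ℤ →₀ ℂ) : Integrable (fun t => ‖trig p t - f t‖) ν :=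
  ((integrable_trig ν p).sub hf).norm

lemma exists_integral_trig_sub_le (ν : Measure Torus) [IsFiniteMeasure ν] {f : Torus → ℂ}
    (hf : Integrable f ν) {ε : ℝ} (hε : 0 < ε) :
    ∃ p, ∫ t, ‖trig p t - f t‖ ∂ν ≤ ε := by
  obtain ⟨g, -, hg, hgc, hgi⟩ :=
    hf.exists_hasCompactSupport_integral_sub_le (half_pos hε)
  set V := ν.real Set.univ
  have hV : 0 ≤ V := measureReal_nonneg
  have hV' : 0 < V + 1 := by positivity
  obtain ⟨p, hp⟩ := exists_norm_trig_sub_le ⟨g, hgc⟩ (ε := ε / 2 / (V + 1)) (by positivity)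
  refine ⟨p, ?_⟩
  have h1 : ∫ t, ‖trig p t - g t‖ ∂ν ≤ ε / 2 := by
    refine (integral_mono_of_nonneg (Eventually.of_forall fun _ => norm_nonneg _)
      (integrable_const (ε / 2 / (V + 1))) (Eventually.of_forall hp)).trans ?_
    rw [integral_const, smul_eq_mul]
    calc V * (ε / 2 / (V + 1)) ≤ (V + 1) * (ε / 2 / (V + 1)) := by gcongr; linarith
      _ = ε / 2 := mul_div_cancel₀ _ hV'.ne'
  have hfg : Integrable (fun t => ‖f t - g t‖) ν := (hf.sub hgi).norm
  have h2 : ∫ t, ‖trig p t - f t‖ ∂ν ≤ ∫ t, (‖trig p t - g t‖ + ‖f t - g t‖) ∂ν := by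
    refine integral_mono_of_nonneg (Eventually.of_forall fun _ => norm_nonneg _)
      ((integrable_norm_trig_sub hgi p).add hfg)
      (Eventually.of_forall fun t => ?_)
    simp only
    rw [norm_sub_rev (f t)]
    exact norm_sub_le_norm_sub_add_norm_sub _ _ _
  rw [integral_add (integrable_norm_trig_sub hgi p) hfg] at h2
  linarith

section extension

variable {E : Type*} [NormedAddCommGroup E] [NormedSpace ℂ E] {Ψ : (ℤ →₀ ℂ) →ₗ[ℂ] E}
  {ν : Measure Torus}

/-- `v` is the value at `f` of the extension by continuity of `Ψ` to `L¹(ν)`. -/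
def IsExtensionValue (Ψ : (ℤ →₀ ℂ) →ₗ[ℂ] E) (ν : Measure Torus) (f : Torus → ℂ) (v : E) : Prop :=
  ∀ ε : ℝ, 0 < ε → ∃ p, ∫ t, ‖trig p t - f t‖ ∂ν ≤ ε ∧ ‖Ψ p - v‖ ≤ ε

lemma isExtensionValue_trig (p : ℤ →₀ ℂ) : IsExtensionValue Ψ ν (trig p) (Ψ p) :=
  fun ε hε => ⟨p, by simpa using hε.le, by simpa using hε.le⟩

variable [IsFiniteMeasure ν] {f g : Torus → ℂ} {v w : E}

lemma IsExtensionValue.add (hf : Integrable f ν) (hg : Integrable g ν)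
    (h : IsExtensionValue Ψ ν f v) (h' : IsExtensionValue Ψ ν g w) :
    IsExtensionValue Ψ ν (fun t => f t + g t) (v + w) := by
  intro ε hε
  obtain ⟨p, hp, hpv⟩ := h (ε / 2) (half_pos hε)
  obtain ⟨q, hq, hqw⟩ := h' (ε / 2) (half_pos hε)
  refine ⟨p + q, ?_, ?_⟩
  · have h1 : ∫ t, ‖trig (p + q) t - (f t + g t)‖ ∂ν
        ≤ ∫ t, (‖trig p t - f t‖ + ‖trig q t - g t‖) ∂ν := by
      refine integral_mono_of_nonneg (Eventually.of_forall fun _ => norm_nonneg _)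
        ((integrable_norm_trig_sub hf p).add (integrable_norm_trig_sub hg q))
        (Eventually.of_forall fun t => ?_)
      simp only
      rw [map_add, ContinuousMap.add_apply, add_sub_add_comm]
      exact norm_add_le _ _
    rw [integral_add (integrable_norm_trig_sub hf p) (integrable_norm_trig_sub hg q)] at h1
    exact h1.trans (by linarith)
  · rw [map_add, add_sub_add_comm]
    exact (norm_add_le _ _).trans (by linarith)

omit [IsFiniteMeasure ν] in
lemma IsExtensionValue.smul (c : ℂ) (h : IsExtensionValue Ψ ν f v) :
    IsExtensionValue Ψ ν (fun t => c * f t) (c • v) := by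
  intro ε hε
  have hc : 0 < ‖c‖ + 1 := by positivity
  have hle : ‖c‖ * (ε / (‖c‖ + 1)) ≤ ε :=
    calc ‖c‖ * (ε / (‖c‖ + 1)) ≤ (‖c‖ + 1) * (ε / (‖c‖ + 1)) := by gcongr; linarith
      _ = ε := mul_div_cancel₀ _ hc.ne'
  obtain ⟨p, hp, hpv⟩ := h (ε / (‖c‖ + 1)) (by positivity)
  refine ⟨c • p, ?_, ?_⟩
  · refine le_trans (le_of_eq ?_) ((mul_le_mul_of_nonneg_left hp (norm_nonneg c)).trans hle)
    rw [← integral_const_mul]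
    refine integral_congr_ae (Eventually.of_forall fun t => ?_)
    simp only
    rw [map_smul, ContinuousMap.smul_apply, smul_eq_mul, ← mul_sub, norm_mul]
  · rw [map_smul, ← smul_sub, norm_smul]
    exact (mul_le_mul_of_nonneg_left hpv (norm_nonneg c)).trans hle

lemma IsExtensionValue.sum {ι : Type*} (s : Finset ι) {f : ι → Torus → ℂ} {v : ι → E}
    (hf : ∀ i ∈ s, Integrable (f i) ν) (h : ∀ i ∈ s, IsExtensionValue Ψ ν (f i) (v i)) :
    IsExtensionValue Ψ ν (fun t => ∑ i ∈ s, f i t) (∑ i ∈ s, v i) := by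
  classical
  induction s using Finset.induction_on with
  | empty => intro ε hε; exact ⟨0, by simpa using hε.le, by simpa using hε.le⟩
  | insert a s ha ih =>
    simp only [Finset.sum_insert ha]
    refine IsExtensionValue.add (hf a (Finset.mem_insert_self a s)) ?_
      (h a (Finset.mem_insert_self a s)) (ih (fun i hi => hf i (Finset.mem_insert_of_mem hi))
        fun i hi => h i (Finset.mem_insert_of_mem hi))
    exact integrable_finsetSum (f := f) s fun i hi => hf i (Finset.mem_insert_of_mem hi)

/-- Domination by `ν` passes from polynomials to limits. With `f = g` this gives uniqueness of the
extension value. -/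
lemma IsExtensionValue.norm_sub_le (hΨ : ∀ p, ‖Ψ p‖ ≤ ∫ t, ‖trig p t‖ ∂ν)
    (hf : Integrable f ν) (hg : Integrable g ν)
    (h : IsExtensionValue Ψ ν f v) (h' : IsExtensionValue Ψ ν g w) :
    ‖v - w‖ ≤ ∫ t, ‖f t - g t‖ ∂ν := by
  refine le_of_forall_pos_le_add fun ε hε => ?_
  obtain ⟨p, hp, hpv⟩ := h (ε / 4) (by positivity)
  obtain ⟨q, hq, hqw⟩ := h' (ε / 4) (by positivity)
  have hpi := integrable_norm_trig_sub hf p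
  have hqi := integrable_norm_trig_sub hg q
  have hpq : Integrable (fun t => ‖trig p t - f t‖ + ‖trig q t - g t‖) ν := hpi.add hqi
  have hfg : Integrable (fun t => ‖f t - g t‖) ν := (hf.sub hg).norm
  have h1 := hΨ (p - q)
  have h2 : ∫ t, ‖trig (p - q) t‖ ∂ν
      ≤ ∫ t, ((‖trig p t - f t‖ + ‖trig q t - g t‖) + ‖f t - g t‖) ∂ν := by
    refine integral_mono_of_nonneg (Eventually.of_forall fun _ => norm_nonneg _)
      (hpq.add hfg) (Eventually.of_forall fun t => ?_)
    simp only
    rw [map_sub, ContinuousMap.sub_apply]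
    calc ‖trig p t - trig q t‖ = ‖(trig p t - f t) - (trig q t - g t) + (f t - g t)‖ := by
          congr 1; ring
      _ ≤ _ := (norm_add_le _ _).trans (add_le_add_left (_root_.norm_sub_le _ _) _)
  rw [integral_add hpq hfg, integral_add hpi hqi] at h2
  have h3 : ‖v - w‖ ≤ ‖Ψ p - v‖ + ‖Ψ q - w‖ + ‖Ψ (p - q)‖ := by
    calc ‖v - w‖ = ‖(Ψ q - w) - (Ψ p - v) + Ψ (p - q)‖ := by
          congr 1; rw [map_sub]; abel
      _ ≤ _ := (norm_add_le _ _).trans (add_le_add_left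
        ((_root_.norm_sub_le _ _).trans_eq (add_comm _ _)) _)
  linarith

lemma IsExtensionValue.norm_le (hΨ : ∀ p, ‖Ψ p‖ ≤ ∫ t, ‖trig p t‖ ∂ν)
    (hf : Integrable f ν) (h : IsExtensionValue Ψ ν f v) : ‖v‖ ≤ ∫ t, ‖f t‖ ∂ν := by
  have h0 : IsExtensionValue Ψ ν (fun _ => 0) 0 := fun ε hε =>
    ⟨0, by simpa using hε.le, by simpa using hε.le⟩
  simpa using h.norm_sub_le hΨ hf (integrable_const 0) h0

lemma exists_isExtensionValue [CompleteSpace E] (hΨ : ∀ p, ‖Ψ p‖ ≤ ∫ t, ‖trig p t‖ ∂ν)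
    (hf : Integrable f ν) : ∃ v, IsExtensionValue Ψ ν f v := by
  choose p hp using fun n : ℕ =>
    exists_integral_trig_sub_le ν hf (ε := 1 / ((n : ℝ) + 1)) (by positivity)
  have hlim : Tendsto (fun n : ℕ => 1 / ((n : ℝ) + 1)) atTop (𝓝 0) :=
    tendsto_one_div_add_atTop_nhds_zero_nat
  have hdist : ∀ m n, dist (Ψ (p m)) (Ψ (p n)) ≤ 1 / ((m : ℝ) + 1) + 1 / ((n : ℝ) + 1) := by
    intro m n
    rw [dist_eq_norm, ← map_sub]
    have hm := integrable_norm_trig_sub hf (p m)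
    have hn := integrable_norm_trig_sub hf (p n)
    have h1 : ∫ t, ‖trig (p m - p n) t‖ ∂ν
        ≤ ∫ t, (‖trig (p m) t - f t‖ + ‖trig (p n) t - f t‖) ∂ν := by
      refine integral_mono_of_nonneg (Eventually.of_forall fun _ => norm_nonneg _)
        (hm.add hn) (Eventually.of_forall fun t => ?_)
      simp only
      rw [map_sub, ContinuousMap.sub_apply, ← sub_sub_sub_cancel_right _ _ (f t)]
      exact _root_.norm_sub_le _ _
    rw [integral_add hm hn] at h1
    linarith [hΨ (p m - p n), hp m, hp n]
  have hC : CauchySeq fun n => Ψ (p n) := by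
    refine cauchySeq_of_le_tendsto_0 (fun N : ℕ => 2 * (1 / ((N : ℝ) + 1))) ?_
      (by simpa using hlim.const_mul 2)
    intro m n N hm hn
    refine (hdist m n).trans ?_
    have : ∀ k, N ≤ k → 1 / ((k : ℝ) + 1) ≤ 1 / ((N : ℝ) + 1) := fun k hk => by gcongr
    linarith [this m hm, this n hn]
  obtain ⟨v, hv⟩ := cauchySeq_tendsto_of_complete hC
  refine ⟨v, fun ε hε => ?_⟩
  obtain ⟨n, h1, h2⟩ := ((hlim.eventually_le_const hε).and
    ((tendsto_iff_norm_sub_tendsto_zero.1 hv).eventually_le_const hε)).exists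
  exact ⟨p n, (hp n).trans h1, h2⟩

end extension

lemma integrable_indicator_one (ν : Measure Torus) [IsFiniteMeasure ν] {s : Set Torus}
    (hs : MeasurableSet s) : Integrable (s.indicator fun _ => (1 : ℂ)) ν :=
  (integrable_const 1).indicator hs

lemma integral_norm_indicator_one (ν : Measure Torus) {s : Set Torus} (hs : MeasurableSet s) :
    ∫ t, ‖s.indicator (fun _ => (1 : ℂ)) t‖ ∂ν = ν.real s := by
  simp_rw [norm_indicator_eq_indicator_norm, norm_one]
  exact integral_indicator_one hs

/-- Approximating an indicator in `L¹(ν + |μ_x|)` makes a single polynomial good for both measures.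
So `μ(s) x` is the extension value for `ν`, whence `‖μ(s) x‖ ≤ ν(s)`, and `ν` has mass at most `C
‖x‖`. -/
lemma sotNorm_le_of_isFejerMultiplier [CompleteSpace H] {μ : VectorMeasure Torus (H →L[ℂ] H)}
    {T : ℤ → H →L[ℂ] H} (hμ : ∀ x, (applyMeasure μ x).variation Set.univ < ∞)
    (hT : ∀ l, HasFourierCoeff μ l (T (-l))) {C : ℝ≥0} (hC : IsFejerMultiplier T C) :
    sotNorm μ ≤ C := by
  refine (sotNorm_le_iff μ C).2 fun x => ?_
  have hx : IsFiniteMeasure (applyMeasure μ x).variation := ⟨hμ x⟩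
  obtain ⟨ν, hν, hνC, hΨ⟩ := (hC.isSumming x).exists_dominating_measure
  have hle : (C * ‖x‖₊ : ℝ≥0) = (C : ℝ≥0∞) * ‖x‖ₑ := by
    rw [ENNReal.coe_mul]; rfl
  rw [hle] at hνC
  refine (VectorMeasure.variation_apply_le_of_forall_enorm_le MeasurableSet.univ
    fun s hs _ => ?_).trans hνC
  have hval : IsExtensionValue (coeffMap fun l => T l x) ν (s.indicator fun _ => 1) (μ s x) := by
    intro ε hε
    set V := (applyMeasure μ x).variation
    obtain ⟨p, hp⟩ := exists_integral_trig_sub_le (ν + V) (integrable_indicator_one (ν + V) hs) hε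
    rw [integral_add_measure (integrable_norm_trig_sub (integrable_indicator_one ν hs) p)
      (integrable_norm_trig_sub (integrable_indicator_one V hs) p)] at hp
    have h4 : 0 ≤ ∫ t, ‖trig p t - s.indicator (fun _ => 1) t‖ ∂ν :=
      integral_nonneg fun _ => norm_nonneg _
    have h5 := norm_coeffMap_sub_le hT x hs p
    have h6 := (norm_nonneg _).trans h5
    exact ⟨p, by linarith, by linarith⟩
  have h := hval.norm_le hΨ (integrable_indicator_one ν hs)
  rw [integral_norm_indicator_one ν hs] at h
  rw [applyMeasure_apply, ← ofReal_norm]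
  exact (ENNReal.ofReal_le_ofReal h).trans_eq (ofReal_measureReal (measure_ne_top _ _))

/-! ### Strongly dominated operator-valued set functions -/

/-- By the parallelogram law, one of the two signs for a new vector increases the squared norm by at
least the square of its norm. -/
lemma exists_signs {ι : Type*} (s : Finset ι) (f : ι → H) :
    ∃ θ : ι → ℂ, (∀ i, ‖θ i‖ = 1) ∧ ∑ i ∈ s, ‖f i‖ ^ 2 ≤ ‖∑ i ∈ s, θ i • f i‖ ^ 2 := by
  classical
  induction s using Finset.induction_on with
  | empty => exact ⟨fun _ => 1, by simp, by simp⟩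
  | insert a s ha ih =>
    obtain ⟨θ, hθ, hle⟩ := ih
    have hpar := parallelogram_law_with_norm ℂ (f a) (∑ i ∈ s, θ i • f i)
    have hsum : ∀ c : ℂ, ∑ i ∈ s, Function.update θ a c i • f i = ∑ i ∈ s, θ i • f i := fun c =>
      Finset.sum_congr rfl fun i hi => by
        rw [Function.update_of_ne (ne_of_mem_of_not_mem hi ha)]
    have hnorm : ∀ c : ℂ, ‖c‖ = 1 → ∀ i, ‖Function.update θ a c i‖ = 1 := fun c hc i => by
      rcases eq_or_ne i a with rfl | hi
      · rwa [Function.update_self]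
      · rw [Function.update_of_ne hi, hθ]
    rcases le_total (‖f a‖ ^ 2 + ‖∑ i ∈ s, θ i • f i‖ ^ 2)
      (‖f a + ∑ i ∈ s, θ i • f i‖ ^ 2) with h | h
    · refine ⟨Function.update θ a 1, hnorm 1 (by simp), ?_⟩
      rw [Finset.sum_insert ha, Finset.sum_insert ha, hsum, Function.update_self, one_smul]
      linarith
    · refine ⟨Function.update θ a (-1), hnorm (-1) (by simp), ?_⟩
      rw [Finset.sum_insert ha, Finset.sum_insert ha, hsum, Function.update_self, neg_one_smul,
        neg_add_eq_sub, norm_sub_rev]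
      nlinarith

/-- A finitely additive operator-valued set function with `‖m(s) x‖ ≤ ν_x(s)` for measures `ν_x`
of total mass at most `C ‖x‖`. -/
structure IsStronglyDominated {X : Type*} [MeasurableSpace X] (m : Set X → H →L[ℂ] H)
    (ν : H → Measure X) (C : ℝ≥0) : Prop where
  finite : ∀ x, IsFiniteMeasure (ν x)
  univ_le : ∀ x, (ν x).real Set.univ ≤ C * ‖x‖
  norm_le : ∀ s, MeasurableSet s → ∀ x, ‖m s x‖ ≤ (ν x).real s
  union : ∀ s t, MeasurableSet s → MeasurableSet t → Disjoint s t → m (s ∪ t) = m s + m t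

namespace IsStronglyDominated

variable {X : Type*} [MeasurableSpace X] {m : Set X → H →L[ℂ] H} {ν : H → Measure X} {C : ℝ≥0}
  (h : IsStronglyDominated m ν C)
include h

lemma empty : m ∅ = 0 := by
  have := h.union ∅ ∅ MeasurableSet.empty MeasurableSet.empty (Set.disjoint_empty _)
  simpa using this

lemma diff {s t : Set X} (hs : MeasurableSet s) (ht : MeasurableSet t) (hst : t ⊆ s) :
    m (s \ t) = m s - m t := by
  rw [eq_sub_iff_add_eq, ← h.union _ _ (hs.diff ht) ht Set.disjoint_sdiff_left,
    Set.sdiff_union_of_subset hst]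

lemma norm_apply_le {s : Set X} (hs : MeasurableSet s) (x : H) : ‖m s x‖ ≤ C * ‖x‖ := by
  have := h.finite x
  exact (h.norm_le s hs x).trans ((measureReal_mono (Set.subset_univ s)).trans (h.univ_le x))

lemma biUnion {ι : Type*} (F : Finset ι) {s : ι → Set X} (hs : ∀ i, MeasurableSet (s i))
    (hd : (F : Set ι).PairwiseDisjoint s) : m (⋃ i ∈ F, s i) = ∑ i ∈ F, m (s i) := by
  classical
  induction F using Finset.induction_on with
  | empty => simpa using h.empty
  | insert a F ha ih =>
    rw [Finset.set_biUnion_insert, Finset.sum_insert ha, h.union _ _ (hs a)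
      (Finset.measurableSet_biUnion _ fun i _ => hs i), ih (hd.subset (by simp))]
    rw [Set.disjoint_iUnion₂_right]
    intro i hi
    exact hd (by simp) (by simp [hi]) fun hai => ha (hai ▸ hi)

/-- Choose `yᵢ` in the unit ball with `‖m(sᵢ)* yᵢ‖ > ε` and signs making `z = ∑ θᵢ m(sᵢ)* yᵢ`
satisfy `‖z‖² ≥ card F · ε²`. Expanding `⟨z, z⟩` gives `‖z‖² ≤ ∑ ‖m(sᵢ) z‖ ≤ ν_z(X) ≤ C ‖z‖`, so
`‖z‖ ≤ C`. -/
lemma card_mul_sq_le [CompleteSpace H] {ι : Type*} (F : Finset ι) {s : ι → Set X}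
    (hs : ∀ i ∈ F, MeasurableSet (s i)) (hd : (F : Set ι).PairwiseDisjoint s) {ε : ℝ}
    (hε : 0 < ε) (hm : ∀ i ∈ F, ε < ‖m (s i)‖) : F.card * ε ^ 2 ≤ C ^ 2 := by
  have hex : ∀ i, ∃ y : H, i ∈ F → ‖y‖ < 1 ∧ ε < ‖(m (s i)).adjoint y‖ := by
    intro i
    by_cases hi : i ∈ F
    · obtain ⟨y, hy⟩ := ContinuousLinearMap.exists_lt_apply_of_lt_opNorm (m (s i)).adjoint
        (r := ε) (by rw [LinearIsometryEquiv.norm_map]; exact hm i hi)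
      exact ⟨y, fun _ => hy⟩
    · exact ⟨0, fun h => (hi h).elim⟩
  choose y hy using hex
  obtain ⟨θ, hθ, hle⟩ := exists_signs F fun i => (m (s i)).adjoint (y i)
  set z := ∑ i ∈ F, θ i • (m (s i)).adjoint (y i) with hz
  have hνz := h.finite z
  have h1 : ‖z‖ ^ 2 ≤ C * ‖z‖ := by
    have h2 : ((‖z‖ ^ 2 : ℝ) : ℂ) = ∑ i ∈ F, (starRingEnd ℂ) (θ i) * inner ℂ (y i) (m (s i) z) := by
      have : ((‖z‖ ^ 2 : ℝ) : ℂ) = inner ℂ z z := by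
        rw [inner_self_eq_norm_sq_to_K]; simp
      rw [this]
      conv_lhs => rw [hz, sum_inner]
      refine Finset.sum_congr rfl fun i _ => ?_
      rw [inner_smul_left, ContinuousLinearMap.adjoint_inner_left]
    have h3 : ‖z‖ ^ 2 = ‖((‖z‖ ^ 2 : ℝ) : ℂ)‖ := by
      rw [Complex.norm_real, Real.norm_of_nonneg (by positivity)]
    rw [h3, h2]
    have h4 : ∑ i ∈ F, (ν z).real (s i) ≤ (ν z).real Set.univ := by
      rw [← measureReal_biUnion_finset hd hs]
      exact measureReal_mono (Set.subset_univ _)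
    refine (norm_sum_le _ _).trans ((Finset.sum_le_sum fun i hi => ?_).trans
      (h4.trans (h.univ_le z)))
    rw [norm_mul, RCLike.norm_conj, hθ, one_mul]
    exact (norm_inner_le_norm _ _).trans ((mul_le_of_le_one_left (norm_nonneg _)
      (hy i hi).1.le).trans (h.norm_le _ (hs i hi) z))
  have h5 : ‖z‖ ≤ C := by
    rcases (norm_nonneg z).eq_or_lt with h0 | h0
    · rw [← h0]; exact C.2
    · rw [sq] at h1
      exact le_of_mul_le_mul_right h1 h0
  calc F.card * ε ^ 2 = ∑ i ∈ F, ε ^ 2 := by rw [Finset.sum_const, nsmul_eq_mul]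
    _ ≤ ∑ i ∈ F, ‖(m (s i)).adjoint (y i)‖ ^ 2 := Finset.sum_le_sum fun i hi =>
        pow_le_pow_left₀ hε.le (hy i hi).2.le 2
    _ ≤ ‖z‖ ^ 2 := hle
    _ ≤ C ^ 2 := pow_le_pow_left₀ (norm_nonneg _) h5 2

/-- A sliding hump argument: strong smallness on a decreasing sequence of sets is uniform. -/
lemma exists_norm_le [CompleteSpace H] {E : ℕ → Set X} (hE : ∀ n, MeasurableSet (E n))
    (hanti : Antitone E)
    (hx : ∀ x, ∀ ε : ℝ, 0 < ε → ∃ n, ∀ s, MeasurableSet s → s ⊆ E n → ‖m s x‖ ≤ ε)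
    {ε : ℝ} (hε : 0 < ε) : ∃ n, ∀ s, MeasurableSet s → s ⊆ E n → ‖m s‖ ≤ ε := by
  by_contra! hcon
  have hstep : ∀ n, ∃ k, n ≤ k ∧ ∃ G, MeasurableSet G ∧ G ⊆ E n ∧ Disjoint G (E k) ∧
      ε < ‖m G‖ := by
    intro n
    obtain ⟨s, hs, hsn, hlt⟩ := hcon n
    obtain ⟨x, hx1, hlt'⟩ := ContinuousLinearMap.exists_lt_apply_of_lt_opNorm (m s) hlt
    -- Removing a tail costs at most half the excess of `‖m s x‖` over `ε`, so what is left of `s`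
    -- still exceeds `ε`.
    obtain ⟨j, hj⟩ := hx x ((‖m s x‖ - ε) / 2) (by linarith)
    refine ⟨max n j, le_max_left _ _, s \ E (max n j), hs.diff (hE _),
      Set.sdiff_subset.trans hsn, Set.disjoint_sdiff_left, ?_⟩
    have h1 : m (s \ E (max n j)) = m s - m (s ∩ E (max n j)) := by
      rw [← Set.sdiff_self_inter, h.diff hs (hs.inter (hE _)) Set.inter_subset_left]
    have h2 := hj (s ∩ E (max n j)) (hs.inter (hE _))
      (Set.inter_subset_right.trans (hanti (le_max_right n j)))
    have h3 : ‖m (s \ E (max n j)) x‖ ≤ ‖m (s \ E (max n j))‖ :=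
      ((m _).le_opNorm x).trans (mul_le_of_le_one_right (norm_nonneg _) hx1.le)
    have h4 : ‖m s x‖ - ‖m (s ∩ E (max n j)) x‖ ≤ ‖m (s \ E (max n j)) x‖ := by
      rw [h1, sub_apply]
      exact norm_sub_norm_le _ _
    linarith
  have hmany : ∀ K n : ℕ, ∃ G : ℕ → Set X, (∀ i ∈ Finset.range K, MeasurableSet (G i)) ∧
      (∀ i ∈ Finset.range K, G i ⊆ E n) ∧
      ((Finset.range K : Finset ℕ) : Set ℕ).PairwiseDisjoint G ∧
      ∀ i ∈ Finset.range K, ε < ‖m (G i)‖ := by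
    intro K
    induction K with
    | zero => intro n; exact ⟨fun _ => ∅, by simp⟩
    | succ K ih =>
      intro n
      obtain ⟨k, hnk, G₀, hG₀, hG₀n, hG₀k, hlt⟩ := hstep n
      obtain ⟨G, hG, hGk, hGd, hGlt⟩ := ih k
      have hmem : ∀ i, i + 1 ∈ Finset.range (K + 1) → i ∈ Finset.range K := by simp
      refine ⟨fun i => Nat.casesOn i G₀ G, ?_, ?_, ?_, ?_⟩
      · rintro (_ | i) hi
        exacts [hG₀, hG i (hmem i hi)]
      · rintro (_ | i) hi
        exacts [hG₀n, (hGk i (hmem i hi)).trans (hanti hnk)]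
      · rintro (_ | i) hi (_ | j) hj hij
        · exact (hij rfl).elim
        · exact hG₀k.mono_right (hGk j (hmem j hj))
        · exact (hG₀k.mono_right (hGk i (hmem i hi))).symm
        · exact hGd (hmem i hi) (hmem j hj) fun h => hij (by rw [h])
      · rintro (_ | i) hi
        exacts [hlt, hGlt i (hmem i hi)]
  obtain ⟨K, hK⟩ := exists_nat_gt ((C : ℝ) ^ 2 / ε ^ 2)
  obtain ⟨G, hG, -, hGd, hGlt⟩ := hmany K 0
  have h1 := h.card_mul_sq_le (Finset.range K) hG hGd hε hGlt
  rw [Finset.card_range] at h1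
  rw [div_lt_iff₀ (by positivity)] at hK
  linarith

/-- The tails `⋃_{i ≥ n} f i` have vanishing `ν_x`-measure for each `x`; `exists_norm_le` makes this
uniform in operator norm. -/
lemma hasSum [CompleteSpace H] {f : ℕ → Set X} (hf : ∀ i, MeasurableSet (f i))
    (hd : Pairwise (Function.onFun Disjoint f)) : HasSum (fun i => m (f i)) (m (⋃ i, f i)) := by
  let E : ℕ → Set X := fun n => ⋃ i ≥ n, f i
  have hE : ∀ n, MeasurableSet (E n) := fun n =>
    MeasurableSet.iUnion fun i => MeasurableSet.iUnion fun _ => hf i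
  have hanti : Antitone E := fun a b hab =>
    Set.iUnion_mono fun i => Set.iUnion_mono' fun hi => ⟨hab.trans hi, subset_rfl⟩
  have hsmall : ∀ x, ∀ ε : ℝ, 0 < ε → ∃ n, ∀ s, MeasurableSet s → s ⊆ E n → ‖m s x‖ ≤ ε := by
    intro x ε hε
    have hfin := h.finite x
    have h1 := tendsto_measure_biUnion_Ici_zero_of_pairwise_disjoint (μ := ν x) (Es := f)
      (fun i => (hf i).nullMeasurableSet) hd
    obtain ⟨n, hn⟩ := (h1.eventually_le_const (ENNReal.ofReal_pos.2 hε)).exists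
    refine ⟨n, fun s hs hsE => (h.norm_le s hs x).trans ?_⟩
    exact ENNReal.toReal_le_of_le_ofReal hε.le ((measure_mono hsE).trans hn)
  rw [HasSum, SummationFilter.unconditional_filter, Metric.tendsto_atTop]
  intro ε hε
  obtain ⟨n, hn⟩ := h.exists_norm_le hE hanti hsmall (half_pos hε)
  refine ⟨Finset.range n, fun F hF => ?_⟩
  have hU := MeasurableSet.iUnion hf
  have hFm : MeasurableSet (⋃ i ∈ F, f i) := Finset.measurableSet_biUnion _ fun i _ => hf i
  rw [dist_comm, dist_eq_norm, ← h.biUnion F hf fun i _ j _ hij => hd hij,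
    ← h.diff hU hFm (Set.iUnion₂_subset fun i _ => Set.subset_iUnion f i)]
  refine (hn _ (hU.diff hFm) ?_).trans_lt (half_lt_self hε)
  rintro t ⟨ht, htF⟩
  obtain ⟨i, hi⟩ := Set.mem_iUnion.1 ht
  refine Set.mem_iUnion₂.2 ⟨i, ?_, hi⟩
  by_contra hlt
  exact htF (Set.mem_iUnion₂.2 ⟨i, hF (Finset.mem_range.2 (not_le.1 hlt)), hi⟩)

end IsStronglyDominated

/-- At stage `n` the set is approximated for the first `n + 1` measures `ν (e j)` of a dense
sequence. Density and the uniform bound `‖μ(t)‖ ≤ C` give smallness at every `x`, and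
`exists_norm_le` makes it uniform. -/
lemma isRegular_of_isStronglyDominated [CompleteSpace H] [TopologicalSpace.SeparableSpace H]
    (μ : VectorMeasure Torus (H →L[ℂ] H)) {ν : H → Measure Torus} {C : ℝ≥0}
    (h : IsStronglyDominated μ ν C) : IsRegular μ := by
  intro s hs ε hε
  have hfin := h.finite
  let e := TopologicalSpace.denseSeq H
  let η : ℕ → Measure Torus := fun n => ∑ j ∈ Finset.range (n + 1), ν (e j)
  have hKex : ∀ n, ∃ K ⊆ s, IsCompact K ∧ η n (s \ K) < ENNReal.ofReal (1 / ((n : ℝ) + 1)) :=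
    fun n => hs.exists_isCompact_sdiff_lt (measure_ne_top _ _)
      (ENNReal.ofReal_pos.2 (by positivity)).ne'
  have hUex : ∀ n, ∃ U ⊇ s, IsOpen U ∧ η n U < ∞ ∧
      η n (U \ s) < ENNReal.ofReal (1 / ((n : ℝ) + 1)) :=
    fun n => hs.exists_isOpen_sdiff_lt (measure_ne_top _ _)
      (ENNReal.ofReal_pos.2 (by positivity)).ne'
  choose K hKs hK hKlt using hKex
  choose U hsU hU _ hUlt using hUex
  -- Finite intersections of the open sets and unions of the compact sets make the gaps decrease, as
  -- the sliding hump requires.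
  let E : ℕ → Set Torus := fun n => (⋂ i ∈ Set.Iic n, U i) \ ⋃ i ∈ Set.Iic n, K i
  have hUo : ∀ n, IsOpen (⋂ i ∈ Set.Iic n, U i) := fun n =>
    (Set.finite_Iic n).isOpen_biInter fun i _ => hU i
  have hKc : ∀ n, IsCompact (⋃ i ∈ Set.Iic n, K i) := fun n =>
    (Set.finite_Iic n).isCompact_biUnion fun i _ => hK i
  have hE : ∀ n, MeasurableSet (E n) := fun n =>
    (hUo n).measurableSet.diff (hKc n).measurableSet
  have hanti : Antitone E := fun a b hab => Set.sdiff_subset_sdiff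
    (Set.biInter_subset_biInter_left (Set.Iic_subset_Iic.2 hab))
    (Set.biUnion_subset_biUnion_left (Set.Iic_subset_Iic.2 hab))
  have hνE : ∀ j n, j ≤ n → ν (e j) (E n) ≤ ENNReal.ofReal (2 * (1 / ((n : ℝ) + 1))) := by
    intro j n hjn
    have h1 : ν (e j) ≤ η n := by
      refine Measure.le_iff.2 fun t _ => ?_
      rw [Measure.finsetSum_apply]
      exact Finset.single_le_sum (f := fun j => ν (e j) t) (fun _ _ => zero_le)
        (Finset.mem_range.2 (by omega))
    have h2 : E n ⊆ (U n \ s) ∪ (s \ K n) := by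
      rintro t ⟨ht, ht'⟩
      have htU : t ∈ U n := Set.mem_iInter₂.1 ht n Set.self_mem_Iic
      have htK : t ∉ K n := fun hK => ht' (Set.mem_iUnion₂.2 ⟨n, Set.self_mem_Iic, hK⟩)
      by_cases hts : t ∈ s
      · exact Or.inr ⟨hts, htK⟩
      · exact Or.inl ⟨htU, hts⟩
    rw [show 2 * (1 / ((n : ℝ) + 1)) = 1 / ((n : ℝ) + 1) + 1 / ((n : ℝ) + 1) from two_mul _,
      ENNReal.ofReal_add (by positivity) (by positivity)]
    exact (h1 _).trans ((measure_mono h2).trans ((measure_union_le _ _).trans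
      (add_le_add (hUlt n).le (hKlt n).le)))
  have hlim : Tendsto (fun n : ℕ => 2 * (1 / ((n : ℝ) + 1))) atTop (𝓝 0) := by
    simpa using (tendsto_one_div_add_atTop_nhds_zero_nat (𝕜 := ℝ)).const_mul 2
  have hsmall : ∀ x, ∀ δ : ℝ, 0 < δ → ∃ n, ∀ t, MeasurableSet t → t ⊆ E n → ‖μ t x‖ ≤ δ := by
    intro x δ hδ
    have hC : (0 : ℝ) < C + 1 := by positivity
    obtain ⟨j, hj⟩ := (TopologicalSpace.denseRange_denseSeq H).exists_dist_lt x
      (ε := δ / 2 / (C + 1)) (by positivity)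
    obtain ⟨n, hn, hjn⟩ := ((hlim.eventually_le_const (half_pos hδ)).and
      (eventually_ge_atTop j)).exists
    refine ⟨n, fun t ht htE => ?_⟩
    have h1 : ‖μ t (e j)‖ ≤ δ / 2 :=
      (h.norm_le t ht (e j)).trans ((ENNReal.toReal_le_of_le_ofReal (by positivity)
        ((measure_mono htE).trans (hνE j n hjn))).trans hn)
    have h2 : ‖μ t (x - e j)‖ ≤ δ / 2 := by
      refine (h.norm_apply_le ht _).trans ?_
      rw [← dist_eq_norm]
      calc C * dist x (e j) ≤ (C + 1) * (δ / 2 / (C + 1)) := by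
            gcongr
            linarith
        _ = δ / 2 := mul_div_cancel₀ _ hC.ne'
    calc ‖μ t x‖ = ‖μ t (x - e j) + μ t (e j)‖ := by rw [← map_add, sub_add_cancel]
      _ ≤ δ := (norm_add_le _ _).trans (by linarith)
  -- The factor `2` pays for passing from the semivariation to the norm of a single value `μ t`.
  obtain ⟨δ, hδ, hδε⟩ : ∃ δ : ℝ, 0 < δ ∧ 2 * ENNReal.ofReal δ < ε := by
    rcases eq_or_ne ε ∞ with rfl | hε'
    · exact ⟨1, one_pos, by simp⟩
    · have := ENNReal.toReal_pos hε.ne' hε'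
      refine ⟨ε.toReal / 4, by positivity, ?_⟩
      rw [show (2 : ℝ≥0∞) = ENNReal.ofReal 2 by simp, ← ENNReal.ofReal_mul zero_le_two,
        ENNReal.ofReal_lt_iff_lt_toReal (by positivity) hε']
      linarith
  obtain ⟨n, hn⟩ := h.exists_norm_le hE hanti hsmall hδ
  refine ⟨_, _, hKc n, hUo n, Set.iUnion₂_subset fun i _ => hKs i,
    Set.subset_iInter₂ fun i _ => hsU i, lt_of_le_of_lt ?_ hδε⟩
  by_contra! hlt
  obtain ⟨t, htE, ht, hlt'⟩ := VectorMeasure.exists_subset_lt_enorm_apply_of_lt_semivariation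
    (hE n) hlt
  refine hlt'.not_ge ?_
  rw [← ofReal_norm]
  gcongr
  exact hn t ht htE

/-! ### Construction of the measure -/

lemma simpleFunc_eq_sum_indicator (s : SimpleFunc Torus ℂ) :
    (fun t => s t) = fun t => ∑ c ∈ s.range, c * (s ⁻¹' {c}).indicator (fun _ => 1) t := by
  classical
  funext t
  rw [Finset.sum_eq_single_of_mem (s t) (SimpleFunc.mem_range_self s t)]
  · rw [Set.indicator_of_mem (show t ∈ s ⁻¹' {s t} from rfl), mul_one]
  · intro c _ hc
    rw [Set.indicator_of_notMem (fun h => hc h.symm), mul_zero]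

/-- The measures `ν_x` need not depend linearly on `x`, but `Ψ_x` does. Linearity of the extension
values follows by approximating an indicator in `L¹` of the sum of the relevant `ν`'s. -/
lemma IsFejerMultiplier.exists_measure [CompleteSpace H] [TopologicalSpace.SeparableSpace H]
    {T : ℤ → H →L[ℂ] H} {C : ℝ≥0} (hC : IsFejerMultiplier T C) :
    ∃ μ : VectorMeasure Torus (H →L[ℂ] H), IsSOTMeasure μ ∧
      ∀ l : ℤ, HasFourierCoeff μ l (T (-l)) := by
  classical
  choose ν hfin hνC hΨ using fun x => (hC.isSumming x).exists_dominating_measure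
  have hνC' : ∀ x, (ν x).real Set.univ ≤ C * ‖x‖ := fun x => by
    have := ENNReal.toReal_mono ENNReal.coe_ne_top (hνC x)
    simpa [measureReal_def] using this
  have hex : ∀ (s : Set Torus) (x : H), ∃ v, MeasurableSet s →
      IsExtensionValue (coeffMap fun l => T l x) (ν x) (s.indicator fun _ => 1) v := by
    intro s x
    by_cases hs : MeasurableSet s
    · obtain ⟨v, hv⟩ := exists_isExtensionValue (hΨ x) (integrable_indicator_one (ν x) hs)
      exact ⟨v, fun _ => hv⟩
    · exact ⟨0, fun h => (hs h).elim⟩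
  choose v hv using hex
  have hvle : ∀ s, MeasurableSet s → ∀ x, ‖v s x‖ ≤ (ν x).real s := fun s hs x => by
    have := (hv s x hs).norm_le (hΨ x) (integrable_indicator_one (ν x) hs)
    rwa [integral_norm_indicator_one _ hs] at this
  have huniq : ∀ (x : H) (f : Torus → ℂ) (a b : H), Integrable f (ν x) →
      IsExtensionValue (coeffMap fun l => T l x) (ν x) f a →
      IsExtensionValue (coeffMap fun l => T l x) (ν x) f b → a = b := by
    intro x f a b hf ha hb
    have := ha.norm_sub_le (hΨ x) hf hf hb
    simpa [sub_eq_zero] using this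
  have happrox : ∀ s, MeasurableSet s → ∀ x p, ‖coeffMap (fun l => T l x) p - v s x‖
      ≤ ∫ t, ‖trig p t - s.indicator (fun _ => 1) t‖ ∂ν x := fun s hs x p =>
    (isExtensionValue_trig p).norm_sub_le (hΨ x) (integrable_trig _ p)
      (integrable_indicator_one _ hs) (hv s x hs)
  have hvadd : ∀ s, MeasurableSet s → ∀ x y, v s (x + y) = v s x + v s y := by
    intro s hs x y
    refine eq_of_forall_dist_le fun ε hε => ?_
    have hint := fun x => integrable_indicator_one (ν x) hs
    obtain ⟨p, hp⟩ := exists_integral_trig_sub_le (ν (x + y) + (ν x + ν y))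
      (integrable_indicator_one _ hs) hε
    rw [integral_add_measure (integrable_norm_trig_sub (hint _) p)
      (integrable_norm_trig_sub (integrable_indicator_one _ hs) p),
      integral_add_measure (integrable_norm_trig_sub (hint _) p)
      (integrable_norm_trig_sub (hint _) p)] at hp
    have h1 := happrox s hs (x + y) p
    have h2 := happrox s hs x p
    have h3 := happrox s hs y p
    have h4 : coeffMap (fun l => T l (x + y)) p
        = coeffMap (fun l => T l x) p + coeffMap (fun l => T l y) p := by
      rw [← coeffMap_clm_apply, ← coeffMap_clm_apply, ← coeffMap_clm_apply, map_add]
    rw [dist_eq_norm]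
    calc ‖v s (x + y) - (v s x + v s y)‖
        = ‖(coeffMap (fun l => T l x) p - v s x) + (coeffMap (fun l => T l y) p - v s y)
          - (coeffMap (fun l => T l (x + y)) p - v s (x + y))‖ := by
          rw [h4]; congr 1; abel
      _ ≤ _ := (norm_sub_le _ _).trans (add_le_add_left (norm_add_le _ _) _)
      _ ≤ ε := by linarith
  have hvsmul : ∀ s, MeasurableSet s → ∀ (c : ℂ) x, v s (c • x) = c • v s x := by
    intro s hs c x
    refine eq_of_forall_dist_le fun ε hε => ?_
    have hint := fun x => integrable_indicator_one (ν x) hs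
    obtain ⟨p, hp⟩ := exists_integral_trig_sub_le (ν (c • x) + ν x)
      (integrable_indicator_one _ hs) (ε := ε / (‖c‖ + 1)) (by positivity)
    rw [integral_add_measure (integrable_norm_trig_sub (hint _) p)
      (integrable_norm_trig_sub (hint _) p)] at hp
    have h1 := happrox s hs (c • x) p
    have h2 := happrox s hs x p
    have h4 : coeffMap (fun l => T l (c • x)) p = c • coeffMap (fun l => T l x) p := by
      rw [← coeffMap_clm_apply, ← coeffMap_clm_apply, map_smul]
    have h5 := (norm_nonneg _).trans h1
    have h6 : 0 ≤ ‖c‖ := norm_nonneg c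
    rw [dist_eq_norm]
    calc ‖v s (c • x) - c • v s x‖
        = ‖c • (coeffMap (fun l => T l x) p - v s x)
          - (coeffMap (fun l => T l (c • x)) p - v s (c • x))‖ := by
          rw [h4, smul_sub]; congr 1; abel
      _ ≤ ‖c‖ * ‖coeffMap (fun l => T l x) p - v s x‖
          + ‖coeffMap (fun l => T l (c • x)) p - v s (c • x)‖ :=
          (norm_sub_le _ _).trans_eq (by rw [norm_smul])
      _ ≤ (‖c‖ + 1) * (ε / (‖c‖ + 1)) := by
          have h7 := (norm_nonneg _).trans h2
          nlinarith
      _ = ε := mul_div_cancel₀ _ (by positivity)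
  -- A `VectorMeasure` must vanish on nonmeasurable sets, hence the default `0`.
  let m : Set Torus → H →L[ℂ] H := fun s =>
    if hs : MeasurableSet s then
      LinearMap.mkContinuous ⟨⟨v s, hvadd s hs⟩, hvsmul s hs⟩ C fun x =>
        (hvle s hs x).trans ((measureReal_mono (Set.subset_univ s)).trans (hνC' x))
    else 0
  have hm : ∀ s, MeasurableSet s → ∀ x, m s x = v s x := fun s hs x => by
    simp only [m, dif_pos hs]
    rfl
  have hdom : IsStronglyDominated m ν C := by
    refine ⟨hfin, hνC', fun s hs x => by rw [hm s hs]; exact hvle s hs x, ?_⟩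
    intro s t hs ht hst
    ext x
    rw [add_apply, hm _ (hs.union ht), hm s hs, hm t ht]
    have h1 := (hv s x hs).add (integrable_indicator_one _ hs) (integrable_indicator_one _ ht)
      (hv t x ht)
    refine huniq x _ _ _ (integrable_indicator_one _ (hs.union ht)) (hv _ x (hs.union ht)) ?_
    rwa [Set.indicator_union_of_disjoint hst]
  let μ : VectorMeasure Torus (H →L[ℂ] H) :=
    { measureOf' := m
      empty' := hdom.empty
      not_measurable' := fun s hs => dif_neg hs
      m_iUnion' := fun f hf hd => hdom.hasSum hf hd }
  have hμ : ∀ s, MeasurableSet s → ∀ x, μ s x = v s x := hm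
  refine ⟨μ, ⟨isRegular_of_isStronglyDominated μ hdom, fun x => ?_⟩, fun l => ?_⟩
  · refine (VectorMeasure.variation_apply_le_of_forall_enorm_le (m := ν x) MeasurableSet.univ
      fun s hs _ => ?_).trans_lt (measure_lt_top _ _)
    rw [applyMeasure_apply, ← ofReal_norm]
    exact (ENNReal.ofReal_le_ofReal (hdom.norm_le s hs x)).trans_eq
      (ofReal_measureReal (measure_ne_top _ _))
  · intro ε hε
    have hC1 : (0 : ℝ) < C + 1 := by positivity
    -- The mass of `ν x` is at most `C ‖x‖`, uniformly enough to give an operator-norm bound; the `+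
    -- 1` allows `C = 0`.
    refine ⟨ε / (C + 1), by positivity, fun s hs => ?_⟩
    refine ContinuousLinearMap.opNorm_le_bound _ hε.le fun x => ?_
    have hsum : IsExtensionValue (coeffMap fun l => T l x) (ν x) s (simpleIntegral μ s x) := by
      have h1 := IsExtensionValue.sum (Ψ := coeffMap fun l => T l x) (ν := ν x) s.range
        (f := fun c t => c * (s ⁻¹' {c}).indicator (fun _ => 1) t)
        (v := fun c => c • v (s ⁻¹' {c}) x)
        (fun c _ => (integrable_indicator_one _ (s.measurableSet_fiber c)).const_mul c)
        (fun c _ => (hv _ x (s.measurableSet_fiber c)).smul c)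
      convert h1 using 1
      · funext t
        have := congrFun (simpleFunc_eq_sum_indicator s) t
        exact this
      · rw [simpleIntegral, sum_apply]
        refine Finset.sum_congr rfl fun c _ => ?_
        rw [smul_apply, hμ _ (s.measurableSet_fiber c)]
    have htrig := isExtensionValue_trig (Ψ := coeffMap fun l => T l x) (ν := ν x)
      (Finsupp.single (-l) 1)
    have h2 := hsum.norm_sub_le (hΨ x) s.integrable_of_isFiniteMeasure
      (integrable_trig _ _) htrig
    have h3 : coeffMap (fun l => T l x) (Finsupp.single (-l) 1) = T (-l) x := by
      rw [coeffMap_apply, Finsupp.sum_single_index (by simp), one_smul]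
    rw [h3] at h2
    rw [sub_apply]
    refine h2.trans ((integral_mono_of_nonneg (Eventually.of_forall fun _ => norm_nonneg _)
      (integrable_const (ε / (C + 1))) (Eventually.of_forall fun t => ?_)).trans ?_)
    · simp only
      rw [trig_single, one_mul]
      exact hs t
    · rw [integral_const, smul_eq_mul]
      calc (ν x).real Set.univ * (ε / (C + 1)) ≤ (C * ‖x‖) * (ε / (C + 1)) := by
            gcongr
            exact hνC' x
        _ ≤ ((C + 1) * ‖x‖) * (ε / (C + 1)) := by gcongr; linarith
        _ = ε * ‖x‖ := by field_simp

end OperatorMatrix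

theorem mainTheorem6 {H : Type*} [NormedAddCommGroup H] [InnerProductSpace ℂ H] [CompleteSpace H]
    [TopologicalSpace.SeparableSpace H] (T : ℤ → H →L[ℂ] H) :
    (OperatorMatrix.IsRightToeplitzMultiplier (OperatorMatrix.toeplitz T) ↔
      ∃ μ : VectorMeasure OperatorMatrix.Torus (H →L[ℂ] H),
        OperatorMatrix.IsSOTMeasure μ ∧ ∀ l : ℤ, OperatorMatrix.HasFourierCoeff μ l (T (-l))) ∧
    ∀ μ : VectorMeasure OperatorMatrix.Torus (H →L[ℂ] H),
      OperatorMatrix.IsSOTMeasure μ → (∀ l : ℤ, OperatorMatrix.HasFourierCoeff μ l (T (-l))) →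
        OperatorMatrix.sotNorm μ < ∞ ∧
        OperatorMatrix.sotNorm μ =
          OperatorMatrix.rightToeplitzMultiplierNorm (OperatorMatrix.toeplitz T) := by
  refine ⟨⟨fun h => ?_, ?_⟩, fun μ hμ hT => ?_⟩
  · obtain ⟨C, hC⟩ := OperatorMatrix.exists_isFejerMultiplier h
    exact hC.exists_measure
  · rintro ⟨μ, hμ, hT⟩
    obtain ⟨C, hC, -⟩ := ENNReal.lt_iff_exists_coe.1 (OperatorMatrix.sotNorm_lt_top hμ.2)
    exact (OperatorMatrix.isFejerMultiplier_of_sotNorm_le hT hC.le).isRightToeplitzMultiplier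
  · have hlt := OperatorMatrix.sotNorm_lt_top hμ.2
    refine ⟨hlt, ?_⟩
    rw [OperatorMatrix.rightToeplitzMultiplierNorm_eq]
    refine le_antisymm (le_iInf₂ fun C hC =>
      OperatorMatrix.sotNorm_le_of_isFejerMultiplier hμ.2 hT hC) ?_
    obtain ⟨C, hC, -⟩ := ENNReal.lt_iff_exists_coe.1 hlt
    rw [hC]
    exact iInf₂_le C (OperatorMatrix.isFejerMultiplier_of_sotNorm_le hT hC.le)
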